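/- Let $k$ be a field, $r\ge 0$, $R=k[x_0,\dots,x_r]$ with the standard grading. For a commutative ring $B$ write $R_B=B[x_0,\dots,x_r]$ and $\mathfrak m=(x_0,\dots,x_r)\subset R_B$ (or $\subset R$ when $B=k$), and let $$\mathrm{Fib}_{R/k}(B)=\{\,I\subset R_B \text{ homogeneous ideal} : R_B/I \text{ and } H^i_{\mathfrak m}(R_B/I)\ (i\ge 0) \text{ are flat over } B\,\}.$$ A fiber-full scheme $\mathrm{Fib}_{R/k}$ is a $k$-scheme that represents $B\mapsto \mathrm{Fib}_{R/k}(B)$ on Noetherian $k$-algebras: its $B$-points over $k$ are in bijection with $\mathrm{Fib}_{R/k}(B)$, and a homomorphism of $k$-algebras $B\to B'$ acts by $I\mapsto I R_{B'}$. Let $I_0\subset R$ be a homogeneous ideal, let $[\mathrm{Hom}_R(I_0,R/I_0)]_0$ be the $k$-vector space of degree-preserving $R$-linear maps $I_0\to R/I_0$, and for such a map $\varphi$ put $$I_\varphi=\{\,f+\varepsilon g : f\in I_0,\ g\in R,\ \varphi(f)=g \bmod I_0\,\}\subset R_{k[\varepsilon]},\qquad \varepsilon^2=0 .$$ Then $$T=\{\,\varphi\in[\mathrm{Hom}_R(I_0,R/I_0)]_0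 : H^i_{\mathfrak m}(\varphi)=0 \text{ as a map } H^i_{\mathfrak m}(I_0)\to H^i_{\mathfrak m}(R/I_0), \text{ for all } i\ge 0\,\}$$ is a $k$-subspace of $[\mathrm{Hom}_R(I_0,R/I_0)]_0$, and it is the tangent space of $\mathrm{Fib}_{R/k}$ at $[I_0]$ in the following sense. 1. The map $\varphi\mapsto I_\varphi$ is a bijection from $T$ onto the set of all $I\in \mathrm{Fib}_{R/k}(k[\varepsilon])$ whose image in $R$ under $\varepsilon\mapsto 0$ is $I_0$. 2. For every fiber-full scheme $\mathrm{Fib}_{R/k}$ there is a $k$-rational point $[I_0]$ of it that corresponds to the ideal $I_0$, and there is a $k$-linear isomorphism from the Zariski tangent space $T_{[I_0]}\mathrm{Fib}_{R/k}=(\mathfrak m_{[I_0]}/\mathfrak m_{[I_0]}^2)^*$ onto $T$ that sends $v$ to $\varphi$ whenever the $k[\varepsilon]$-point given by $v$ corresponds to the ideal $I_\varphi$. -/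

import Mathlib

universe u

noncomputable section

open CategoryTheory AlgebraicGeometry

attribute [local instance] MvPolynomial.gradedAlgebra

namespace FiberFull

/-! ### Homogeneous ideals of polynomial rings and local cohomology -/

/-- The standard graded polynomial ring `B[x_0, …, x_r]`. -/
abbrev PolyRing (r : ℕ) (B : Type u) [CommRing B] : Type u :=
  MvPolynomial (Fin (r + 1)) B

/-- The graded irrelevant ideal `𝔪 = (x_0, …, x_r)`. -/
def irrelevantIdeal (r : ℕ) (B : Type u) [CommRing B] : Ideal (PolyRing r B) :=
  Ideal.span (Set.range MvPolynomial.X)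

/-- Homogeneous ideals for the standard grading of `B[x_0, …, x_r]`. -/
def IsHomogeneousIdeal {r : ℕ} {B : Type u} [CommRing B] (I : Ideal (PolyRing r B)) : Prop :=
  I.IsHomogeneous (MvPolynomial.homogeneousSubmodule (Fin (r + 1)) B)

/-- The local cohomology functor `H^i_𝔪` on modules over `B[x_0, …, x_r]`. -/
def localCoh (r : ℕ) (B : Type u) [CommRing B] (i : ℕ) :
    ModuleCat.{u} (PolyRing r B) ⥤ ModuleCat.{u} (PolyRing r B) :=
  localCohomology (irrelevantIdeal r B) i

/-- The map `H^i_𝔪(φ) : H^i_𝔪(M) ⟶ H^i_𝔪(N)` induced by an `R`-linear map `φ : M → N`. -/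
def localCohMap {r : ℕ} {B : Type u} [CommRing B] (i : ℕ) {M N : Type u}
    [AddCommGroup M] [Module (PolyRing r B) M] [AddCommGroup N] [Module (PolyRing r B) N]
    (φ : M →ₗ[PolyRing r B] N) :
    (localCoh r B i).obj (ModuleCat.of (PolyRing r B) M) ⟶
      (localCoh r B i).obj (ModuleCat.of (PolyRing r B) N) :=
  (localCoh r B i).map (ModuleCat.ofHom φ)

/-! ### The fiber-full functor -/

/-- The value at `B` of the fiber-full functor: the homogeneous ideals `I` of
`R_B = B[x_0, …, x_r]` such that `R_B / I` and all the local cohomology modules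
`H^i_𝔪(R_B / I)` are flat over `B`. -/
def fib (r : ℕ) (B : Type u) [CommRing B] : Set (Ideal (PolyRing r B)) :=
  {I | IsHomogeneousIdeal I ∧ Module.Flat B (PolyRing r B ⧸ I) ∧
    ∀ i : ℕ, Module.Flat B ((ModuleCat.restrictScalars (algebraMap B (PolyRing r B))).obj
      ((localCoh r B i).obj (ModuleCat.of (PolyRing r B) (PolyRing r B ⧸ I))))}

/-- Base change of an ideal of `R_B` along `f : B → B'`: the ideal of `R_{B'}` generated by its
image. When `R_B / I` is `B`-flat this is `I ⊗_B B'`, viewed inside `R_{B'}`. -/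
def baseChange {r : ℕ} {B B' : Type u} [CommRing B] [CommRing B'] (f : B →+* B')
    (I : Ideal (PolyRing r B)) : Ideal (PolyRing r B') :=
  I.map (MvPolynomial.map f)

/-- The value at the Artinian local `k`-algebra `B`, with residue map `π : B → k`, of the local
fiber-full functor of `I₀`: the elements of `fib r B` with closed fiber `I₀`. -/
def localFib {r : ℕ} {k B : Type u} [CommRing k] [CommRing B] (I₀ : Ideal (PolyRing r k))
    (π : B →+* k) : Set (Ideal (PolyRing r B)) :=
  {I | I ∈ fib r B ∧ baseChange π I = I₀}

/-! ### First order deformations of a homogeneous ideal -/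

/-- `[Hom_R(I₀, R/I₀)]_0`: the `R`-linear maps `φ : I₀ → R/I₀` that send elements of degree `ν`
to elements of degree `ν`, for all `ν`. -/
def homDegreeZero {r : ℕ} {k : Type u} [Field k] (I₀ : Ideal (PolyRing r k)) :
    Submodule k (I₀ →ₗ[PolyRing r k] (PolyRing r k ⧸ I₀)) where
  carrier := {φ | ∀ (ν : ℕ) (f : I₀),
    (f : PolyRing r k) ∈ MvPolynomial.homogeneousSubmodule (Fin (r + 1)) k ν →
      ∃ g ∈ MvPolynomial.homogeneousSubmodule (Fin (r + 1)) k ν, φ f = Ideal.Quotient.mk I₀ g}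
  add_mem' := by
    intro φ ψ hφ hψ ν f hf
    obtain ⟨g, hg, hg'⟩ := hφ ν f hf
    obtain ⟨h, hh, hh'⟩ := hψ ν f hf
    exact ⟨g + h, Submodule.add_mem _ hg hh, by simp [hg', hh']⟩
  zero_mem' := fun ν f _ => ⟨0, Submodule.zero_mem _, by simp⟩
  smul_mem' := by
    intro c φ hφ ν f hf
    obtain ⟨g, hg, hg'⟩ := hφ ν f hf
    exact ⟨c • g, Submodule.smul_mem _ c hg, by
      rw [LinearMap.smul_apply, hg']; rfl⟩

/-- The element `f + ε g` of `k[ε][x_0, …, x_r]`. -/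
def addEps {r : ℕ} {k : Type u} [Field k] (f g : PolyRing r k) : PolyRing r (DualNumber k) :=
  MvPolynomial.map (TrivSqZeroExt.inlHom k k) f +
    MvPolynomial.C DualNumber.eps * MvPolynomial.map (TrivSqZeroExt.inlHom k k) g

lemma exists_addEps {r : ℕ} {k : Type u} [Field k] (F : PolyRing r (DualNumber k)) :
    ∃ f g : PolyRing r k, F = addEps f g := by
  induction F using MvPolynomial.induction_on with
  | C a =>
    refine ⟨MvPolynomial.C a.fst, MvPolynomial.C a.snd, ?_⟩
    simp only [addEps, MvPolynomial.map_C, ← map_mul, ← map_add]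
    congr 1
    ext <;> simp
  | add p q hp hq =>
    obtain ⟨f, g, rfl⟩ := hp
    obtain ⟨f', g', rfl⟩ := hq
    refine ⟨f + f', g + g', ?_⟩
    simp only [addEps, map_add]
    ring
  | mul_X p n hp =>
    obtain ⟨f, g, rfl⟩ := hp
    refine ⟨f * MvPolynomial.X n, g * MvPolynomial.X n, ?_⟩
    simp only [addEps, map_mul, MvPolynomial.map_X]
    ring

lemma addEps_mul {r : ℕ} {k : Type u} [Field k] (a b f g : PolyRing r k) :
    addEps a b * addEps f g = addEps (a * f) (a * g + b * f) := by
  have h : (MvPolynomial.C DualNumber.eps : PolyRing r (DualNumber k)) *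
      MvPolynomial.C DualNumber.eps = 0 := by
    rw [← map_mul, DualNumber.eps_mul_eps, map_zero]
  simp only [addEps, map_mul, map_add]
  linear_combination (MvPolynomial.map (TrivSqZeroExt.inlHom k k) b *
    MvPolynomial.map (TrivSqZeroExt.inlHom k k) g) * h

/-- The first order deformation of `I₀` given by `φ : I₀ → R/I₀`: the ideal
`{f + ε g | f ∈ I₀, φ(f) = g mod I₀}` of `k[ε][x_0, …, x_r]`. -/
def deformationIdeal {r : ℕ} {k : Type u} [Field k] {I₀ : Ideal (PolyRing r k)}
    (φ : I₀ →ₗ[PolyRing r k] (PolyRing r k ⧸ I₀)) : Ideal (PolyRing r (DualNumber k)) where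
  carrier := {F | ∃ (f : I₀) (g : PolyRing r k),
    φ f = Ideal.Quotient.mk I₀ g ∧ F = addEps (f : PolyRing r k) g}
  add_mem' := by
    rintro _ _ ⟨f, g, h, rfl⟩ ⟨f', g', h', rfl⟩
    refine ⟨f + f', g + g', by simp [h, h'], ?_⟩
    simp only [addEps, map_add, Submodule.coe_add]
    ring
  zero_mem' := ⟨0, 0, by simp, by simp [addEps]⟩
  smul_mem' := by
    rintro F _ ⟨f, g, h, rfl⟩
    obtain ⟨a, b, rfl⟩ := exists_addEps F
    refine ⟨a • f, a * g + b * f, ?_, ?_⟩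
    · rw [map_smul, h, map_add, map_mul, map_mul, Ideal.Quotient.eq_zero_iff_mem.mpr f.2,
        mul_zero, add_zero]
      rfl
    · simp [smul_eq_mul, addEps_mul]

/-! ### Schemes over `k`, their points and tangent spaces at rational points -/

/-- The `B`-valued points over `k` of the `k`-scheme `s : X ⟶ Spec k`. -/
@[ext]
structure Points {k : Type u} [Field k] {X : Scheme.{u}} (s : X ⟶ Spec (CommRingCat.of k))
    (B : Type u) [CommRing B] [Algebra k B] : Type u where
  /-- the underlying morphism of schemes -/
  hom : Spec (CommRingCat.of B) ⟶ X
  /-- it is a morphism over `k` -/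
  hom_comp : hom ≫ s = Spec.map (CommRingCat.ofHom (algebraMap k B))

/-- The map on points induced by a homomorphism of `k`-algebras. -/
def Points.map {k : Type u} [Field k] {X : Scheme.{u}} {s : X ⟶ Spec (CommRingCat.of k)}
    {B B' : Type u} [CommRing B] [Algebra k B] [CommRing B'] [Algebra k B'] (f : B →ₐ[k] B')
    (p : Points s B) : Points s B' :=
  ⟨Spec.map (CommRingCat.ofHom f.toRingHom) ≫ p.hom, by
    rw [Category.assoc, p.hom_comp, ← Spec.map_comp, ← CommRingCat.ofHom_comp]
    congr 2
    exact f.comp_algebraMap⟩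

/-- The point of the underlying space of `X` that a `k`-rational point singles out. -/
def Points.point {k : Type u} [Field k] {X : Scheme.{u}} {s : X ⟶ Spec (CommRingCat.of k)}
    (x : Points s k) : X :=
  x.hom (IsLocalRing.closedPoint (CommRingCat.of k))

/-- The local ring `𝒪_{X,x}` at (the image of) a `k`-rational point `x`. -/
def Stalk {k : Type u} [Field k] {X : Scheme.{u}} {s : X ⟶ Spec (CommRingCat.of k)}
    (x : Points s k) : Type u :=
  X.presheaf.stalk x.point

instance {k : Type u} [Field k] {X : Scheme.{u}} {s : X ⟶ Spec (CommRingCat.of k)}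
    (x : Points s k) : CommRing (Stalk x) :=
  inferInstanceAs (CommRing (X.presheaf.stalk x.point))

instance {k : Type u} [Field k] {X : Scheme.{u}} {s : X ⟶ Spec (CommRingCat.of k)}
    (x : Points s k) : IsLocalRing (Stalk x) :=
  inferInstanceAs (IsLocalRing (X.presheaf.stalk x.point))

/-- The structure homomorphism `k → 𝒪_{X,x}`. -/
def structureHom {k : Type u} [Field k] {X : Scheme.{u}} {s : X ⟶ Spec (CommRingCat.of k)}
    (x : Points s k) :
    CommRingCat.of k ⟶ X.presheaf.stalk x.point :=
  (Scheme.ΓSpecIso (CommRingCat.of k)).inv ≫ s.appTop ≫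
    X.presheaf.germ ⊤ x.point trivial

instance {k : Type u} [Field k] {X : Scheme.{u}} {s : X ⟶ Spec (CommRingCat.of k)}
    (x : Points s k) : Algebra k (Stalk x) :=
  RingHom.toAlgebra (R := k) (S := Stalk x) (structureHom x).hom

lemma fromSpecStalk_structure {k : Type u} [Field k] {X : Scheme.{u}}
    {s : X ⟶ Spec (CommRingCat.of k)} (x : Points s k) :
    X.fromSpecStalk x.point ≫ s = Spec.map (structureHom x) := by
  suffices H : ∀ y : X, X.fromSpecStalk y ≫ s =
      Spec.map ((Scheme.ΓSpecIso (CommRingCat.of k)).inv ≫ s.appTop ≫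
        X.presheaf.germ ⊤ y trivial) from H x.point
  intro y
  have h : s = X.toSpecΓ ≫ Spec.map s.appTop ≫
      Spec.map (Scheme.ΓSpecIso (CommRingCat.of k)).inv := by
    rw [← Category.assoc, ← Scheme.toSpecΓ_naturality, Category.assoc,
      toSpecΓ_SpecMap_ΓSpecIso_inv, Category.comp_id]
  conv_lhs => rw [h]
  rw [← Category.assoc, Scheme.fromSpecStalk_toSpecΓ, Spec.map_comp, Spec.map_comp,
    Category.assoc]

/-- Evaluation of germs at the `k`-rational point `x`. -/
def evalHom {k : Type u} [Field k] {X : Scheme.{u}} {s : X ⟶ Spec (CommRingCat.of k)}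
    (x : Points s k) : X.presheaf.stalk x.point ⟶ CommRingCat.of k :=
  Scheme.stalkClosedPointTo (R := CommRingCat.of k) x.hom

lemma evalHom_fromSpecStalk {k : Type u} [Field k] {X : Scheme.{u}}
    {s : X ⟶ Spec (CommRingCat.of k)} (x : Points s k) :
    Spec.map (evalHom x) ≫ X.fromSpecStalk x.point = x.hom :=
  Scheme.Spec_stalkClosedPointTo_fromSpecStalk (R := CommRingCat.of k) x.hom

lemma structureHom_evalHom {k : Type u} [Field k] {X : Scheme.{u}}
    {s : X ⟶ Spec (CommRingCat.of k)} (x : Points s k) :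
    structureHom x ≫ evalHom x = 𝟙 (CommRingCat.of k) := by
  apply Spec.map_injective
  rw [Spec.map_comp, ← fromSpecStalk_structure, ← Category.assoc, evalHom_fromSpecStalk,
    x.hom_comp]
  rfl

/-- Evaluation of germs at the `k`-rational point `x`, as a homomorphism of `k`-algebras. -/
def eval {k : Type u} [Field k] {X : Scheme.{u}} {s : X ⟶ Spec (CommRingCat.of k)}
    (x : Points s k) : Stalk x →ₐ[k] k :=
  { (evalHom x).hom with
    commutes' := fun a => congrArg (fun f => f.hom a) (structureHom_evalHom x) }

/-- The Zariski tangent space `T_x X = (𝔪_x / 𝔪_x²)^*` at the `k`-rational point `x`. -/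
abbrev TangentSpace {k : Type u} [Field k] {X : Scheme.{u}} {s : X ⟶ Spec (CommRingCat.of k)}
    (x : Points s k) : Type u :=
  Module.Dual k (IsLocalRing.CotangentSpace (Stalk x))

lemma sub_eval_mem {k : Type u} [Field k] {X : Scheme.{u}} {s : X ⟶ Spec (CommRingCat.of k)}
    (x : Points s k) (a : Stalk x) :
    a - algebraMap k (Stalk x) (eval x a) ∈ IsLocalRing.maximalIdeal (Stalk x) := by
  rw [IsLocalRing.mem_maximalIdeal, mem_nonunits_iff]
  intro h
  have h0 := h.map (eval x)
  simp at h0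

/-- The differential `a ↦ [a - a(x)]`, from `𝒪_{X,x}` to `𝔪_x / 𝔪_x²`. -/
def differential {k : Type u} [Field k] {X : Scheme.{u}} {s : X ⟶ Spec (CommRingCat.of k)}
    (x : Points s k) : Stalk x →ₗ[k] IsLocalRing.CotangentSpace (Stalk x) :=
  ((IsLocalRing.maximalIdeal (Stalk x)).toCotangent.restrictScalars k).comp
    ((LinearMap.id - (Algebra.linearMap k (Stalk x)).comp (eval x).toLinearMap).codRestrict
      ((IsLocalRing.maximalIdeal (Stalk x)).restrictScalars k) (fun a => sub_eval_mem x a))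

lemma differential_one {k : Type u} [Field k] {X : Scheme.{u}}
    {s : X ⟶ Spec (CommRingCat.of k)} (x : Points s k) : differential x 1 = 0 := by
  have h : differential x 1 = (IsLocalRing.maximalIdeal (Stalk x)).toCotangent
      ⟨1 - algebraMap k (Stalk x) (eval x 1), sub_eval_mem x 1⟩ := rfl
  rw [h, Ideal.toCotangent_eq_zero]
  simp

lemma differential_mul {k : Type u} [Field k] {X : Scheme.{u}}
    {s : X ⟶ Spec (CommRingCat.of k)} (x : Points s k) (a b : Stalk x) :
    differential x (a * b) = eval x a • differential x b + eval x b • differential x a := by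
  have key : ∀ c, differential x c = (IsLocalRing.maximalIdeal (Stalk x)).toCotangent
      ⟨c - algebraMap k (Stalk x) (eval x c), sub_eval_mem x c⟩ := fun _ => rfl
  rw [← map_smul, ← map_smul, ← map_add, key, key, Ideal.toCotangent_eq]
  have h := Ideal.mul_mem_mul (sub_eval_mem x a) (sub_eval_mem x b)
  rw [← pow_two] at h
  convert h using 1
  simp only [map_add, map_mul, Algebra.smul_def, AlgHom.commutes, Algebra.algebraMap_self,
    RingHom.id_apply]
  ring

/-- The `k`-algebra homomorphism `𝒪_{X,x} → k[ε]`, `a ↦ a(x) + ε v([a - a(x)])`, given by a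
tangent vector `v`. -/
def tangentHom {k : Type u} [Field k] {X : Scheme.{u}} {s : X ⟶ Spec (CommRingCat.of k)}
    (x : Points s k) (v : TangentSpace x) : Stalk x →ₐ[k] DualNumber k :=
  AlgHom.ofLinearMap
    ((TrivSqZeroExt.inlAlgHom k k k).toLinearMap.comp (eval x).toLinearMap +
      (TrivSqZeroExt.inrHom k k).comp (v.comp (differential x)))
    (by
      ext <;> simp [differential_one])
    (by
      intro a b
      ext
      · simp
      · simp [differential_mul, mul_comm])

/-- `tangentHom` as a morphism in the category of commutative rings. -/
def tangentStalkHom {k : Type u} [Field k] {X : Scheme.{u}} {s : X ⟶ Spec (CommRingCat.of k)}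
    (x : Points s k) (v : TangentSpace x) :
    X.presheaf.stalk x.point ⟶ CommRingCat.of (DualNumber k) :=
  CommRingCat.ofHom (R := Stalk x) (tangentHom x v).toRingHom

lemma structureHom_tangentStalkHom {k : Type u} [Field k] {X : Scheme.{u}}
    {s : X ⟶ Spec (CommRingCat.of k)} (x : Points s k) (v : TangentSpace x) :
    structureHom x ≫ tangentStalkHom x v = CommRingCat.ofHom (algebraMap k (DualNumber k)) :=
  CommRingCat.hom_ext (RingHom.ext fun a => (tangentHom x v).commutes a)

/-- The `k[ε]`-valued point `Spec k[ε] → Spec 𝒪_{X,x} → X` given by a tangent vector at `x`. -/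
def tangentPoint {k : Type u} [Field k] {X : Scheme.{u}} {s : X ⟶ Spec (CommRingCat.of k)}
    (x : Points s k) (v : TangentSpace x) : Points s (DualNumber k) where
  hom := Spec.map (tangentStalkHom x v) ≫ X.fromSpecStalk x.point
  hom_comp := by
    rw [Category.assoc, fromSpecStalk_structure, ← Spec.map_comp, structureHom_tangentStalkHom]

/-! ### The fiber-full scheme -/

/-- A fiber-full scheme `Fib_{R/k}` for `R = k[x_0, …, x_r]`: a `k`-scheme that represents the
functor `B ↦ fib r B` on Noetherian `k`-algebras. The bijection between the `B`-points of the scheme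
and the elements of `fib r B` is natural in `B` for the base change of ideals. -/
structure FiberFullScheme (r : ℕ) (k : Type u) [Field k] where
  /-- the scheme -/
  X : Scheme.{u}
  /-- its structure morphism -/
  s : X ⟶ Spec (CommRingCat.of k)
  /-- the homogeneous ideal that corresponds to a `B`-point -/
  ideal : ∀ (B : Type u) [CommRing B] [Algebra k B] [IsNoetherianRing B],
    Points s B → Ideal (PolyRing r B)
  ideal_injective : ∀ (B : Type u) [CommRing B] [Algebra k B] [IsNoetherianRing B],
    Function.Injective (ideal B)
  range_ideal : ∀ (B : Type u) [CommRing B] [Algebra k B] [IsNoetherianRing B],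
    Set.range (ideal B) = fib r B
  ideal_map : ∀ (B B' : Type u) [CommRing B] [Algebra k B] [IsNoetherianRing B]
    [CommRing B'] [Algebra k B'] [IsNoetherianRing B'] (f : B →ₐ[k] B') (p : Points s B),
    ideal B' (p.map f) = baseChange f.toRingHom (ideal B p)

end FiberFull

end

/-! Ideals. Flatness of `R[ε]/I` over `k[ε]`, for `I` with reduction `I₀`, says that `εg ∈ I`
exactly when `g ∈ I₀`. Hence the ε-part of a lift of `f ∈ I₀` to `I` is determined modulo `I₀`, and
`I` is the graph `I_φ` of a unique degree-preserving `φ : I₀ → R/I₀` (`exists_deformationIdeal_eq`).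

Local cohomology. A `k[ε]`-module is flat iff the kernel of `ε` equals its image
(`DualNumber.flat_iff`). On `Q = R[ε]/I_φ` the element `ε` acts as `Q → R/I₀ → Q` for an extension
`0 → R/I₀ → Q → R/I₀ → 0`. By induction along the long exact sequence, all `H^i(Q)` are flat iff all
connecting maps `H^i(R/I₀) → H^{i+1}(R/I₀)` vanish (`LocCoh.smul_exact_iff`). Restricted to `R`,
which is harmless because `R → R[ε]` is flat, this extension receives a map from `0 → I₀ → R → R/I₀
→ 0` that is `φ` on the left and `-1` on the right. So its connecting map is, up to sign,
`H^{i+1}(φ) ∘ δ` (`connecting_closedFiber_eq_zero_iff`).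

It remains to remove `δ` (`map_eq_zero_iff_connecting`). In degrees at most `r` the local cohomology
of `R` vanishes, so every class of `H^i(I₀)` comes from `δ`, or is zero if `i = 0`. In degrees above
`r` the target `H^i(R/I₀)` vanishes because `dim R/I₀ ≤ r`, unless `I₀ = 0`, where the source
vanishes.

Tangent space. Tangent vectors at `x` are the `k[ε]`-points reducing to `x`, so representability
gives a bijection with `T`. For linearity, two vectors are joined into one point over `k[ε₁,
ε₂]/(ε₁, ε₂)²`. A single lift `f + ε₁g + ε₂h` in its ideal specializes under `ε₁ ↦ cε`, `ε₂ ↦ dε` to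
all combinations at once (`deformationIdeal_linear`).

The arguments use Yoneda products and extension classes, so they run in `LocCoh`, a direct limit of
derived-category `Ext` groups, which is identified with the functor `localCohomology`. -/

noncomputable section

open CategoryTheory

/-! ### Comparison of `Ext` in the derived category with `Ext` as a derived functor, through
cocycles. -/

namespace CategoryTheory.ProjectiveResolution

open HomologicalComplex

variable {R : Type u} [CommRing R] {X X' Y Y' : ModuleCat.{u} R}

/-- The `n`-cocycles of `Hom(P, Y)`. -/
def cocycles (P : ProjectiveResolution X) (n : ℕ) (Y : ModuleCat.{u} R) :
    Submodule R (P.complex.X n ⟶ Y) where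
  carrier := {f | P.complex.d (n + 1) n ≫ f = 0}
  add_mem' {f g} hf hg := by
    change P.complex.d (n + 1) n ≫ (f + g) = 0
    rw [Preadditive.comp_add, show _ = _ from hf, show _ = _ from hg, add_zero]
  zero_mem' := by simp
  smul_mem' r f hf := by
    change P.complex.d (n + 1) n ≫ (r • f) = 0
    rw [Linear.comp_smul, show _ = _ from hf, smul_zero]

lemma d_comp_cocycle (P : ProjectiveResolution X) {n : ℕ} (z : P.cocycles n Y) :
    P.complex.d (n + 1) n ≫ z.1 = 0 := z.2

/-- The action on cocycles of a map of resolutions and a map of coefficients. -/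
def cocyclesMap {P : ProjectiveResolution X} {P' : ProjectiveResolution X'}
    (φ : P'.complex ⟶ P.complex) (g : Y ⟶ Y') (n : ℕ) :
    P.cocycles n Y →ₗ[R] P'.cocycles n Y' where
  toFun z := ⟨φ.f n ≫ z.1 ≫ g, by
    have h : P.complex.d (n + 1) n ≫ z.1 = 0 := z.2
    change P'.complex.d (n + 1) n ≫ φ.f n ≫ z.1 ≫ g = 0
    rw [← φ.comm_assoc, reassoc_of% h, Limits.zero_comp, Limits.comp_zero]⟩
  map_add' a b := Subtype.ext (by simp)
  map_smul' a b := Subtype.ext (by simp)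

section Derived

/-- `Hom(-, Y)` as a functor to the opposite category. -/
abbrev homOp (Y : ModuleCat.{u} R) : ModuleCat.{u} R ⥤ (ModuleCat.{u} R)ᵒᵖ :=
  ((linearYoneda R (ModuleCat.{u} R)).obj Y).rightOp

/-- The complex `Hom(P, Y)` as a chain complex in the opposite category. -/
abbrev homComplex (P : ProjectiveResolution X) (Y : ModuleCat.{u} R) :
    ChainComplex (ModuleCat.{u} R)ᵒᵖ ℕ :=
  ((homOp Y).mapHomologicalComplex _).obj P.complex

/-- The inclusion of the cocycles, in the opposite category. -/
def cocyclesι (P : ProjectiveResolution X) (n : ℕ) (Y : ModuleCat.{u} R) :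
    (P.homComplex Y).X n ⟶ Opposite.op (ModuleCat.of R (P.cocycles n Y)) :=
  (ModuleCat.ofHom (P.cocycles n Y).subtype).op

lemma d_comp_cocyclesι (P : ProjectiveResolution X) (n : ℕ) (Y : ModuleCat.{u} R) :
    (P.homComplex Y).d (n + 1) n ≫ P.cocyclesι n Y = 0 := by
  apply Quiver.Hom.unop_inj
  ext z
  exact z.2

/-- The map from cocycles to opcycles. -/
def cocyclesOp (P : ProjectiveResolution X) (n : ℕ) (Y : ModuleCat.{u} R) :
    (P.homComplex Y).opcycles n ⟶ Opposite.op (ModuleCat.of R (P.cocycles n Y)) :=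
  (P.homComplex Y).descOpcycles (P.cocyclesι n Y) (n + 1) (by simp) (P.d_comp_cocyclesι n Y)

/-- `Ext` is the homology of `Hom(P, Y)`. -/
def derivedIso (P : ProjectiveResolution X) (n : ℕ) (Y : ModuleCat.{u} R) :
    ((homOp Y).leftDerived n).obj X ≅ (P.homComplex Y).homology n :=
  P.isoLeftDerivedObj (homOp Y) n

/-- The class of a cocycle in the derived functor `Ext`. -/
def derivedClass (P : ProjectiveResolution X) (n : ℕ) (Y : ModuleCat.{u} R) :
    P.cocycles n Y →ₗ[R] (((_root_.Ext R (ModuleCat.{u} R) n).obj (Opposite.op X)).obj Y) :=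
  ((P.derivedIso n Y).hom ≫ (P.homComplex Y).homologyι n ≫
    P.cocyclesOp n Y).unop.hom

lemma p_comp_cocyclesOp (P : ProjectiveResolution X) (n : ℕ) (Y : ModuleCat.{u} R) :
    (P.homComplex Y).pOpcycles n ≫ P.cocyclesOp n Y = P.cocyclesι n Y :=
  p_descOpcycles ..

/-- Passing to the opposite category exchanges cycles and opcycles: after `unop`, `pOpcycles` is an
injection into `Hom(P_n, Y)` whose values are cocycles. -/
lemma cocyclesOp_unop_surjective (P : ProjectiveResolution X) (n : ℕ) (Y : ModuleCat.{u} R) :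
    Function.Surjective (P.cocyclesOp n Y).unop.hom := by
  intro c
  have hinj : Function.Injective ((P.homComplex Y).pOpcycles n).unop.hom :=
    (ModuleCat.mono_iff_injective _).1 inferInstance
  have hz : P.complex.d (n + 1) n ≫ (((P.homComplex Y).pOpcycles n).unop.hom c :
      P.complex.X n ⟶ Y) = 0 :=
    congrArg (fun f => f.unop.hom c) ((P.homComplex Y).d_pOpcycles (n + 1) n)
  refine ⟨⟨((P.homComplex Y).pOpcycles n).unop.hom c, hz⟩, hinj ?_⟩
  exact congrArg (fun f : (P.homComplex Y).X n ⟶ _ => f.unop.hom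
    (⟨((P.homComplex Y).pOpcycles n).unop.hom c, hz⟩ : P.cocycles n Y)) (P.p_comp_cocyclesOp n Y)

lemma derivedClass_surjective (P : ProjectiveResolution X) (n : ℕ) (Y : ModuleCat.{u} R) :
    Function.Surjective (P.derivedClass n Y) := by
  have h1 : Function.Surjective (P.derivedIso n Y).hom.unop.hom :=
    (ModuleCat.epi_iff_surjective _).1 inferInstance
  have h2 : Function.Surjective ((P.homComplex Y).homologyι n).unop.hom :=
    (ModuleCat.epi_iff_surjective _).1 inferInstance
  exact h1.comp (h2.comp (P.cocyclesOp_unop_surjective n Y))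

/-- The index `next n` is `n - 1` for positive `n`; for `n = 0` it defaults to `0`, where the
differential is zero, so the condition becomes `z = 0`. The same form in `extClassHom_eq_zero_iff`
makes the two kernels literally equal. -/
lemma derivedClass_eq_zero_iff (P : ProjectiveResolution X) (n : ℕ) (Y : ModuleCat.{u} R)
    (z : P.cocycles n Y) :
    P.derivedClass n Y z = 0 ↔
      ∃ g : P.complex.X ((ComplexShape.down ℕ).next n) ⟶ Y, P.complex.d n _ ≫ g = z.1 := by
  have h1 : Function.Injective (P.derivedIso n Y).hom.unop.hom :=
    (ModuleCat.mono_iff_injective _).1 inferInstance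
  -- Homology is the kernel of the map out of opcycles; after `unop` it is the cokernel of the
  -- coboundary map into the cocycles.
  have hex := (ShortComplex.exact_of_f_is_kernel
    (ShortComplex.mk ((P.homComplex Y).homologyι n)
      ((P.homComplex Y).fromOpcycles n ((ComplexShape.down ℕ).next n)) (by simp))
    ((P.homComplex Y).homologyIsKernel n _ rfl)).unop
  rw [ShortComplex.moduleCat_exact_iff] at hex
  have hfac : ∀ g : P.complex.X ((ComplexShape.down ℕ).next n) ⟶ Y,
      ((P.homComplex Y).pOpcycles n).unop.hom
        (((P.homComplex Y).fromOpcycles n ((ComplexShape.down ℕ).next n)).unop.hom g) =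
      P.complex.d n _ ≫ g := fun g =>
    congrArg (fun f => f.unop.hom g)
      ((P.homComplex Y).p_fromOpcycles n ((ComplexShape.down ℕ).next n))
  have hz : ((P.homComplex Y).pOpcycles n).unop.hom ((P.cocyclesOp n Y).unop.hom z) = z.1 :=
    congrArg (fun f => f.unop.hom z) (P.p_comp_cocyclesOp n Y)
  have hinj : Function.Injective ((P.homComplex Y).pOpcycles n).unop.hom :=
    (ModuleCat.mono_iff_injective _).1 inferInstance
  refine (map_eq_zero_iff (P.derivedIso n Y).hom.unop.hom h1).trans ?_
  constructor
  · intro h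
    obtain ⟨g, hg⟩ := hex _ h
    exact ⟨g, (hfac g).symm.trans ((congrArg _ hg).trans hz)⟩
  · rintro ⟨g, hg⟩
    have h3 : (P.cocyclesOp n Y).unop.hom z =
        ((P.homComplex Y).fromOpcycles n ((ComplexShape.down ℕ).next n)).unop.hom g :=
      hinj (hz.trans (hg.symm.trans (hfac g).symm))
    refine (congrArg ((P.homComplex Y).homologyι n).unop.hom h3).trans ?_
    exact congrArg (fun f : (P.homComplex Y).homology n ⟶ (P.homComplex Y).X _ => f.unop.hom g)
      ((P.homComplex Y).homologyι_comp_fromOpcycles n ((ComplexShape.down ℕ).next n))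

lemma derivedClass_naturality_left {P : ProjectiveResolution X} {P' : ProjectiveResolution X'}
    {f : X' ⟶ X} (φ : Hom P' P f) (n : ℕ) (z : P.cocycles n Y) :
    (((_root_.Ext R (ModuleCat.{u} R) n).map f.op).app Y).hom (P.derivedClass n Y z) =
      P'.derivedClass n Y (cocyclesMap φ.hom (𝟙 Y) n z) := by
  let ψ : P'.homComplex Y ⟶ P.homComplex Y := ((homOp Y).mapHomologicalComplex _).map φ.hom
  have h : ((homOp Y).leftDerived n).map f ≫ (P.derivedIso n Y).hom =
      (P'.derivedIso n Y).hom ≫ homologyMap ψ n :=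
    isoLeftDerivedObj_hom_naturality f P' P φ.hom φ.hom_f_zero_comp_π_f_zero (homOp Y) n
  have h3 : opcyclesMap ψ n ≫ P.cocyclesOp n Y =
      P'.cocyclesOp n Y ≫ (ModuleCat.ofHom (cocyclesMap φ.hom (𝟙 Y) n) :
        ModuleCat.of R (P.cocycles n Y) ⟶ ModuleCat.of R (P'.cocycles n Y)).op := by
    rw [← cancel_epi (pOpcycles _ _), p_opcyclesMap_assoc, p_comp_cocyclesOp,
      ← Category.assoc, p_comp_cocyclesOp]
    apply Quiver.Hom.unop_inj
    refine ModuleCat.hom_ext (LinearMap.ext fun z => ?_)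
    change φ.hom.f n ≫ z.1 = φ.hom.f n ≫ z.1 ≫ 𝟙 Y
    rw [Category.comp_id]
  have h4 : ((homOp Y).leftDerived n).map f ≫ (P.derivedIso n Y).hom ≫
      (P.homComplex Y).homologyι n ≫ P.cocyclesOp n Y = (P'.derivedIso n Y).hom ≫
        (P'.homComplex Y).homologyι n ≫ P'.cocyclesOp n Y ≫
          (ModuleCat.ofHom (cocyclesMap φ.hom (𝟙 Y) n)).op := by
    rw [reassoc_of% h, homologyι_naturality_assoc, h3]
  exact congrArg (fun f => f.unop.hom z) h4

lemma derivedClass_naturality_right (P : ProjectiveResolution X) (g : Y ⟶ Y') (n : ℕ)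
    (z : P.cocycles n Y) :
    (((_root_.Ext R (ModuleCat.{u} R) n).obj (Opposite.op X)).map g).hom (P.derivedClass n Y z) =
      P.derivedClass n Y' (cocyclesMap (𝟙 P.complex) g n z) := by
  let α : homOp Y' ⟶ homOp Y := NatTrans.rightOp ((linearYoneda R (ModuleCat.{u} R)).map g)
  let ψ : P.homComplex Y' ⟶ P.homComplex Y := (NatTrans.mapHomologicalComplex α _).app P.complex
  have h : (NatTrans.leftDerived α n).app X =
      (P.derivedIso n Y').hom ≫ homologyMap ψ n ≫ (P.derivedIso n Y).inv :=
    leftDerived_app_eq α P n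
  have h3 : opcyclesMap ψ n ≫ P.cocyclesOp n Y =
      P.cocyclesOp n Y' ≫ (ModuleCat.ofHom (cocyclesMap (𝟙 P.complex) g n) :
        ModuleCat.of R (P.cocycles n Y) ⟶ ModuleCat.of R (P.cocycles n Y')).op := by
    rw [← cancel_epi (pOpcycles _ _), p_opcyclesMap_assoc, p_comp_cocyclesOp,
      ← Category.assoc, p_comp_cocyclesOp]
    apply Quiver.Hom.unop_inj
    refine ModuleCat.hom_ext (LinearMap.ext fun z => ?_)
    change z.1 ≫ g = 𝟙 _ ≫ z.1 ≫ g
    rw [Category.id_comp]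
  have h4 : (NatTrans.leftDerived α n).app X ≫ (P.derivedIso n Y).hom ≫
      (P.homComplex Y).homologyι n ≫ P.cocyclesOp n Y = (P.derivedIso n Y').hom ≫
        (P.homComplex Y').homologyι n ≫ P.cocyclesOp n Y' ≫
          (ModuleCat.ofHom (cocyclesMap (𝟙 P.complex) g n)).op := by
    rw [h, Category.assoc, Category.assoc, Iso.inv_hom_id_assoc, homologyι_naturality_assoc, h3]
  exact congrArg (fun f => f.unop.hom z) h4

end Derived

section Comparison

/-- The class of a cocycle in the derived category `Ext`. -/
def extClassHom (P : ProjectiveResolution X) (n : ℕ) (Y : ModuleCat.{u} R) :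
    P.cocycles n Y →ₗ[R] Abelian.Ext X Y n where
  toFun z := P.extMk z.1 (n + 1) rfl (P.d_comp_cocycle z)
  map_add' z z' := (P.add_extMk z.1 z'.1 (n + 1) rfl (P.d_comp_cocycle z) (P.d_comp_cocycle z')).symm
  map_smul' r z := by
    rw [RingHom.id_apply, Abelian.Ext.smul_eq_comp_mk₀, extMk_comp_mk₀]
    simp

lemma extClassHom_surjective (P : ProjectiveResolution X) (n : ℕ) (Y : ModuleCat.{u} R) :
    Function.Surjective (P.extClassHom n Y) := fun α => by
  obtain ⟨f, hf, h⟩ := P.extMk_surjective α (n + 1) rfl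
  exact ⟨⟨f, hf⟩, h⟩

/-- In positive degree this is the usual coboundary criterion. In degree `0` the resolution, seen as
a cochain complex, has no term in degree `1`, so the only coboundary is zero. -/
lemma extClassHom_eq_zero_iff (P : ProjectiveResolution X) (n : ℕ) (Y : ModuleCat.{u} R)
    (z : P.cocycles n Y) :
    P.extClassHom n Y z = 0 ↔
      ∃ g : P.complex.X ((ComplexShape.down ℕ).next n) ⟶ Y, P.complex.d n _ ≫ g = z.1 := by
  cases n with
  | zero =>
    have hd : P.complex.d 0 ((ComplexShape.down ℕ).next 0) = 0 :=
      P.complex.shape _ _ (by simp)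
    simp only [hd, Limits.zero_comp]
    constructor
    · intro h
      have h' := congrArg P.extEquivCohomologyClass h
      rw [extClassHom, LinearMap.coe_mk, AddHom.coe_mk, extEquivCohomologyClass_extMk,
        extEquivCohomologyClass_zero, CochainComplex.HomComplex.CohomologyClass.mk_eq_zero_iff,
        CochainComplex.HomComplex.Cocycle.toSingleMk_mem_coboundaries_iff _ _ _ _ _ 1
          (by lia)] at h'
      obtain ⟨g, hg⟩ := h'
      have hX : Limits.IsZero (P.cochainComplex.X 1) :=
        P.cochainComplex.isZero_of_isStrictlyLE 0 1 (by lia)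
      rw [hX.eq_of_tgt (P.cochainComplex.d _ _) 0, Limits.zero_comp, eq_comm,
        Preadditive.IsIso.comp_left_eq_zero] at hg
      exact ⟨0, hg.symm⟩
    · rintro ⟨-, hg⟩
      have : z = 0 := Subtype.ext hg.symm
      rw [this, map_zero]
  | succ p =>
    rw [show (ComplexShape.down ℕ).next (p + 1) = p from
      (ComplexShape.down ℕ).next_eq' (by simp)]
    exact P.extMk_eq_zero_iff z.1 (p + 1 + 1) rfl (P.d_comp_cocycle z) p rfl

lemma mk₀_comp_extClassHom {P : ProjectiveResolution X} {P' : ProjectiveResolution X'}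
    {f : X' ⟶ X} (φ : Hom P' P f) (n : ℕ) (z : P.cocycles n Y) :
    (Abelian.Ext.mk₀ f).comp (P.extClassHom n Y z) (zero_add n) =
      P'.extClassHom n Y (cocyclesMap φ.hom (𝟙 Y) n z) := by
  refine (mk₀_comp_extMk z.1 (n + 1) rfl (P.d_comp_cocycle z) φ).trans ?_
  simp only [extClassHom, LinearMap.coe_mk, AddHom.coe_mk, cocyclesMap, Category.comp_id]

lemma extClassHom_comp_mk₀ (P : ProjectiveResolution X) (g : Y ⟶ Y') (n : ℕ)
    (z : P.cocycles n Y) :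
    (P.extClassHom n Y z).comp (Abelian.Ext.mk₀ g) (add_zero n) =
      P.extClassHom n Y' (cocyclesMap (𝟙 P.complex) g n z) := by
  refine (P.extMk_comp_mk₀ z.1 (n + 1) rfl (P.d_comp_cocycle z) g).trans ?_
  simp only [extClassHom, LinearMap.coe_mk, AddHom.coe_mk, cocyclesMap, HomologicalComplex.id_f,
    Category.id_comp]

end Comparison

end CategoryTheory.ProjectiveResolution

namespace CategoryTheory.Abelian.Ext

variable {R : Type u} [CommRing R] {X X' Y Y' : ModuleCat.{u} R}

/-- The comparison between `Ext` in the derived category and `Ext` as a derived functor. -/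
def derivedEquiv (X Y : ModuleCat.{u} R) (n : ℕ) :
    Abelian.Ext X Y n ≃ₗ[R]
      (((_root_.Ext R (ModuleCat.{u} R) n).obj (Opposite.op X)).obj Y) :=
  let P := projectiveResolution X
  ((P.extClassHom n Y).quotKerEquivOfSurjective (P.extClassHom_surjective n Y)).symm ≪≫ₗ
    Submodule.quotEquivOfEq _ _ (by
      ext z
      rw [LinearMap.mem_ker, LinearMap.mem_ker, P.extClassHom_eq_zero_iff,
        P.derivedClass_eq_zero_iff]) ≪≫ₗ
    (P.derivedClass n Y).quotKerEquivOfSurjective (P.derivedClass_surjective n Y)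

/-- Every class is represented by a cocycle, so this formula determines the equivalence and reduces
both naturality statements to cocycles. -/
lemma derivedEquiv_extClassHom (n : ℕ) (z : (projectiveResolution X).cocycles n Y) :
    derivedEquiv X Y n ((projectiveResolution X).extClassHom n Y z) =
      (projectiveResolution X).derivedClass n Y z := by
  rw [derivedEquiv, LinearEquiv.trans_apply, LinearEquiv.trans_apply]
  have h : ((projectiveResolution X).extClassHom n Y).quotKerEquivOfSurjective
      ((projectiveResolution X).extClassHom_surjective n Y) (Submodule.Quotient.mk z) =
      (projectiveResolution X).extClassHom n Y z := rfl
  rw [← h, LinearEquiv.symm_apply_apply]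
  rfl

lemma derivedEquiv_mk₀_comp (f : X' ⟶ X) (n : ℕ) (x : Abelian.Ext X Y n) :
    derivedEquiv X' Y n ((mk₀ f).comp x (zero_add n)) =
      (((_root_.Ext R (ModuleCat.{u} R) n).map f.op).app Y).hom (derivedEquiv X Y n x) := by
  obtain ⟨z, rfl⟩ := (projectiveResolution X).extClassHom_surjective n Y x
  let φ : ProjectiveResolution.Hom (projectiveResolution X') (projectiveResolution X) f :=
    ⟨ProjectiveResolution.lift f _ _, ProjectiveResolution.lift_commutes_zero f _ _⟩
  rw [derivedEquiv_extClassHom, ProjectiveResolution.mk₀_comp_extClassHom φ,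
    derivedEquiv_extClassHom, ProjectiveResolution.derivedClass_naturality_left φ]

lemma derivedEquiv_comp_mk₀ (g : Y ⟶ Y') (n : ℕ) (x : Abelian.Ext X Y n) :
    derivedEquiv X Y' n (x.comp (mk₀ g) (add_zero n)) =
      (((_root_.Ext R (ModuleCat.{u} R) n).obj (Opposite.op X)).map g).hom
        (derivedEquiv X Y n x) := by
  obtain ⟨z, rfl⟩ := (projectiveResolution X).extClassHom_surjective n Y x
  rw [derivedEquiv_extClassHom, ProjectiveResolution.extClassHom_comp_mk₀,
    derivedEquiv_extClassHom, ProjectiveResolution.derivedClass_naturality_right]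

end CategoryTheory.Abelian.Ext

end

/-! ### Local cohomology as a direct limit of `Ext` groups, and its long exact sequence. -/

noncomputable section

open CategoryTheory

/-- The module `R / J ^ n`. -/
abbrev Ideal.powQuot {R : Type u} [CommRing R] (J : Ideal R) (n : ℕ) : ModuleCat.{u} R :=
  ModuleCat.of R (R ⧸ J ^ n)

/-- The projection `R / J ^ m → R / J ^ n` for `n ≤ m`. -/
def Ideal.powQuotMap {R : Type u} [CommRing R] (J : Ideal R) {n m : ℕ} (h : n ≤ m) :
    J.powQuot m ⟶ J.powQuot n :=
  ModuleCat.ofHom (Submodule.mapQ _ _ LinearMap.id (Ideal.pow_le_pow_right h))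

lemma Ideal.powQuotMap_refl {R : Type u} [CommRing R] (J : Ideal R) (n : ℕ) :
    J.powQuotMap (le_refl n) = 𝟙 _ :=
  ModuleCat.hom_ext (Submodule.mapQ_id _)

lemma Ideal.powQuotMap_comp {R : Type u} [CommRing R] (J : Ideal R) {n m p : ℕ} (h : n ≤ m)
    (h' : m ≤ p) : J.powQuotMap h' ≫ J.powQuotMap h = J.powQuotMap (h.trans h') :=
  ModuleCat.hom_ext (LinearMap.ext fun x => by
    obtain ⟨x, rfl⟩ := Submodule.Quotient.mk_surjective _ x
    rfl)

/-- The transition maps of the system `Ext^i(R / J ^ n, M)`. -/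
def extTransition {R : Type u} [CommRing R] (J : Ideal R) (i : ℕ) (M : ModuleCat.{u} R)
    (n m : ℕ) (h : n ≤ m) :
    Abelian.Ext (J.powQuot n) M i →ₗ[R] Abelian.Ext (J.powQuot m) M i where
  toFun x := (Abelian.Ext.mk₀ (J.powQuotMap h)).comp x (zero_add i)
  map_add' _ _ := Abelian.Ext.comp_add _ _ _ _
  map_smul' _ _ := Abelian.Ext.comp_smul _ _ _ _

lemma extTransition_apply {R : Type u} [CommRing R] (J : Ideal R) (i : ℕ) (M : ModuleCat.{u} R)
    {n m : ℕ} (h : n ≤ m) (x : Abelian.Ext (J.powQuot n) M i) :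
    extTransition J i M n m h x =
      (Abelian.Ext.mk₀ (J.powQuotMap h)).comp x (zero_add i) := rfl

/-- Multiplication by a class in `Ext^j(M, N)`. -/
def extPostcomp {R : Type u} [CommRing R] (X : ModuleCat.{u} R) {M N : ModuleCat.{u} R}
    {i j k : ℕ} (e : Abelian.Ext M N j) (h : i + j = k) :
    Abelian.Ext X M i →ₗ[R] Abelian.Ext X N k where
  toFun x := x.comp e h
  map_add' _ _ := Abelian.Ext.add_comp _ _ _ _
  map_smul' _ _ := Abelian.Ext.smul_comp _ _ _ _

lemma extPostcomp_apply {R : Type u} [CommRing R] (X : ModuleCat.{u} R) {M N : ModuleCat.{u} R}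
    {i j k : ℕ} (e : Abelian.Ext M N j) (h : i + j = k) (x : Abelian.Ext X M i) :
    extPostcomp X e h x = x.comp e h := rfl

instance {R : Type u} [CommRing R] (J : Ideal R) (i : ℕ) (M : ModuleCat.{u} R) :
    DirectedSystem (fun n => Abelian.Ext (J.powQuot n) M i)
      (fun n m h => extTransition J i M n m h) where
  map_self n x := by
    rw [extTransition_apply, Ideal.powQuotMap_refl, Abelian.Ext.mk₀_id_comp]
  map_map n m p h h' x := by
    rw [extTransition_apply, extTransition_apply, extTransition_apply,
      Abelian.Ext.mk₀_comp_mk₀_assoc, Ideal.powQuotMap_comp]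

/-- Local cohomology with support in `J`, as the direct limit of the groups `Ext^i(R / J ^ n, M)`
in the derived category. -/
def LocCoh {R : Type u} [CommRing R] (J : Ideal R) (i : ℕ) (M : ModuleCat.{u} R) : Type u :=
  Module.DirectLimit (fun n => Abelian.Ext (J.powQuot n) M i) (extTransition J i M)

namespace LocCoh

variable {R : Type u} [CommRing R] {J : Ideal R} {i : ℕ} {M N K : ModuleCat.{u} R}

instance : AddCommGroup (LocCoh J i M) :=
  inferInstanceAs (AddCommGroup (Module.DirectLimit _ (extTransition J i M)))

instance : Module R (LocCoh J i M) :=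
  inferInstanceAs (Module R (Module.DirectLimit _ (extTransition J i M)))

/-- The class in local cohomology of an element of `Ext^i(R / J ^ n, M)`. -/
def of (n : ℕ) : Abelian.Ext (J.powQuot n) M i →ₗ[R] LocCoh J i M :=
  Module.DirectLimit.of R ℕ (fun n => Abelian.Ext (J.powQuot n) M i) (extTransition J i M) n

lemma of_transition {n m : ℕ} (h : n ≤ m) (x : Abelian.Ext (J.powQuot n) M i) :
    of m ((Abelian.Ext.mk₀ (J.powQuotMap h)).comp x (zero_add i)) = of n x :=
  Module.DirectLimit.of_f (f := extTransition J i M) (hij := h)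

lemma exists_of (x : LocCoh J i M) : ∃ n y, of n y = x :=
  Module.DirectLimit.exists_of (f := extTransition J i M) x

lemma of_eq_zero_iff {n : ℕ} {x : Abelian.Ext (J.powQuot n) M i} :
    of n x = 0 ↔ ∃ m, ∃ h : n ≤ m,
      (Abelian.Ext.mk₀ (J.powQuotMap h)).comp x (zero_add i) = 0 := by
  constructor
  · exact fun h => Module.DirectLimit.of.zero_exact (f := extTransition J i M) h
  · rintro ⟨m, h, hx⟩
    rw [← of_transition h, hx, map_zero]

/-- The map on local cohomology given by multiplication by a class in `Ext^j(M, N)`. -/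
def comp {j k : ℕ} (e : Abelian.Ext M N j) (h : i + j = k) : LocCoh J i M →ₗ[R] LocCoh J k N :=
  Module.DirectLimit.lift R ℕ _ (extTransition J i M)
    (fun n => (of n).comp (extPostcomp (J.powQuot n) e h))
    (fun n m hnm x => by
      rw [LinearMap.comp_apply, LinearMap.comp_apply, extPostcomp_apply, extPostcomp_apply,
        extTransition_apply, ← of_transition hnm, Abelian.Ext.comp_assoc _ _ _ _ _ (by omega)])

@[simp]
lemma comp_of {j k n : ℕ} (e : Abelian.Ext M N j) (h : i + j = k)
    (x : Abelian.Ext (J.powQuot n) M i) : comp e h (of n x) = of n (x.comp e h) :=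
  Module.DirectLimit.lift_of (f := extTransition J i M) _ _ x

lemma comp_comp {j j' k l jj' : ℕ} (e : Abelian.Ext M N j) (h : i + j = k)
    (e' : Abelian.Ext N K j') (h' : k + j' = l) (hj : j + j' = jj') (x : LocCoh J i M) :
    comp e' h' (comp e h x) = comp (e.comp e' hj) (by omega) x := by
  obtain ⟨n, x, rfl⟩ := exists_of x
  rw [comp_of, comp_of, comp_of, Abelian.Ext.comp_assoc _ _ _ _ _ (by omega)]

lemma comp_zero {j k : ℕ} (h : i + j = k) (x : LocCoh J i M) :
    comp (0 : Abelian.Ext M N j) h x = 0 := by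
  obtain ⟨n, x, rfl⟩ := exists_of x
  rw [comp_of, Abelian.Ext.comp_zero, map_zero]

/-- The map on local cohomology induced by a linear map. -/
abbrev map (f : M ⟶ N) : LocCoh J i M →ₗ[R] LocCoh J i N :=
  comp (Abelian.Ext.mk₀ f) (add_zero i)

lemma zero_map (x : LocCoh J i M) : map (0 : M ⟶ N) x = 0 := by
  rw [map, Abelian.Ext.mk₀_zero, comp_zero]

lemma map_map (f : M ⟶ N) (g : N ⟶ K) (x : LocCoh J i M) : map g (map f x) = map (f ≫ g) x := by
  rw [comp_comp _ _ _ _ (add_zero 0), Abelian.Ext.mk₀_comp_mk₀]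

lemma map_id (x : LocCoh J i M) : map (𝟙 M) x = x := by
  obtain ⟨n, x, rfl⟩ := exists_of x
  rw [comp_of, Abelian.Ext.comp_mk₀_id]

lemma map_smul_id (r : R) (x : LocCoh J i M) : map (r • 𝟙 M) x = r • x := by
  obtain ⟨n, x, rfl⟩ := exists_of x
  rw [comp_of, ← Abelian.Ext.smul_eq_comp_mk₀, map_smul]

lemma add_map (f g : M ⟶ N) (x : LocCoh J i M) : map (f + g) x = map f x + map g x := by
  obtain ⟨n, x, rfl⟩ := exists_of x
  rw [comp_of, comp_of, comp_of, Abelian.Ext.mk₀_add, Abelian.Ext.comp_add, map_add]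

section Exact

variable {S : ShortComplex (ModuleCat.{u} R)}

/-- Exactness survives the direct limit: a class that dies in the limit already dies at a finite
stage `m`, where the long exact sequence of `Ext(R / J ^ m, -)` applies. The other two exactness
lemmas follow the same pattern. -/
lemma exists_of_map_g_eq_zero (hS : S.ShortExact) (x : LocCoh J i S.X₂)
    (h : map S.g x = 0) :
    ∃ y, map S.f y = x := by
  obtain ⟨n, x, rfl⟩ := exists_of x
  rw [comp_of, of_eq_zero_iff] at h
  obtain ⟨m, hm, h⟩ := h
  obtain ⟨y, hy⟩ := Abelian.Ext.covariant_sequence_exact₂ _ hS _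
    ((Abelian.Ext.comp_assoc _ _ _ _ _ (by omega)).trans h)
  exact ⟨of m y, by rw [comp_of, hy, of_transition]⟩

lemma δ_map_g (hS : S.ShortExact) {k : ℕ} (hk : i + 1 = k) (x : LocCoh J i S.X₂) :
    comp hS.extClass hk (map S.g x) = 0 := by
  rw [comp_comp _ _ _ _ (zero_add 1), hS.comp_extClass, comp_zero]

lemma exists_of_δ_eq_zero (hS : S.ShortExact) {k : ℕ} (hk : i + 1 = k)
    (x : LocCoh J i S.X₃) (h : comp hS.extClass hk x = 0) : ∃ y, map S.g y = x := by
  obtain ⟨n, x, rfl⟩ := exists_of x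
  rw [comp_of, of_eq_zero_iff] at h
  obtain ⟨m, hm, h⟩ := h
  obtain ⟨y, hy⟩ := Abelian.Ext.covariant_sequence_exact₃ _ hS _ hk
    ((Abelian.Ext.comp_assoc _ _ _ _ _ (by omega)).trans h)
  exact ⟨of m y, by rw [comp_of, hy, of_transition]⟩

lemma exists_of_map_f_eq_zero (hS : S.ShortExact) {k : ℕ} (hk : i + 1 = k)
    (x : LocCoh J k S.X₁) (h : map S.f x = 0) : ∃ y : LocCoh J i S.X₃, comp hS.extClass hk y = x := by
  obtain ⟨n, x, rfl⟩ := exists_of x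
  rw [comp_of, of_eq_zero_iff] at h
  obtain ⟨m, hm, h⟩ := h
  obtain ⟨y, hy⟩ := Abelian.Ext.covariant_sequence_exact₁ _ hS _
    ((Abelian.Ext.comp_assoc _ _ _ _ _ (by omega)).trans h) hk
  exact ⟨of m y, by rw [comp_of, hy, of_transition]⟩

end Exact

lemma map_injective_of_mono (f : M ⟶ N) [Mono f] :
    Function.Injective (map f : LocCoh J 0 M →ₗ[R] LocCoh J 0 N) := by
  rw [injective_iff_map_eq_zero]
  intro x h
  obtain ⟨n, x, rfl⟩ := exists_of x
  rw [comp_of, of_eq_zero_iff] at h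
  obtain ⟨m, hm, h⟩ := h
  rw [← of_transition hm]
  have h' : ((Abelian.Ext.mk₀ (J.powQuotMap hm)).comp x (zero_add 0)).comp
      (Abelian.Ext.mk₀ f) (add_zero 0) = 0 :=
    (Abelian.Ext.comp_assoc _ _ _ _ _ (by omega)).trans h
  have h0 := Abelian.Ext.postcomp_mk₀_injective_of_mono (J.powQuot m) f
    (a₁ := (Abelian.Ext.mk₀ (J.powQuotMap hm)).comp x (zero_add 0)) (a₂ := 0)
    (h'.trans (_root_.map_zero _).symm)
  rw [h0, map_zero]

/-- Every local cohomology class is killed by a power of `x ∈ J`. -/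
lemma exists_pow_smul_eq_zero {a : R} (ha : a ∈ J) (x : LocCoh J i M) :
    ∃ n : ℕ, a ^ n • x = 0 := by
  obtain ⟨n, x, rfl⟩ := exists_of x
  refine ⟨n, ?_⟩
  have h0 : a ^ n • 𝟙 (J.powQuot n) = 0 := by
    refine ModuleCat.hom_ext (LinearMap.ext fun y => ?_)
    obtain ⟨y, rfl⟩ := Submodule.Quotient.mk_surjective _ y
    refine (Submodule.Quotient.mk_eq_zero _).2 ?_
    exact Ideal.mul_mem_right _ _ (Ideal.pow_mem_pow ha n)
  rw [← map_smul]
  have : a ^ n • x = (Abelian.Ext.mk₀ (a ^ n • 𝟙 (J.powQuot n))).comp x (zero_add i) := by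
    rw [Abelian.Ext.mk₀_smul, Abelian.Ext.smul_comp, Abelian.Ext.mk₀_id_comp]
  rw [this, h0, Abelian.Ext.mk₀_zero, Abelian.Ext.zero_comp, map_zero]

/-- Each class is killed by some power of `a`, and injectivity of `a` strips these powers one at a
time. -/
lemma subsingleton_of_smul_injective {a : R} (ha : a ∈ J)
    (h : ∀ x : LocCoh J i M, a • x = 0 → x = 0) : Subsingleton (LocCoh J i M) := by
  refine subsingleton_of_forall_eq 0 fun x => ?_
  obtain ⟨n, hn⟩ := exists_pow_smul_eq_zero ha x
  induction n with
  | zero => simpa using hn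
  | succ n ih => exact ih (h _ (by rw [← mul_smul, ← pow_succ', hn]))

lemma subsingleton_of_subsingleton (M : ModuleCat.{u} R) [Subsingleton M] (i : ℕ) :
    Subsingleton (LocCoh J i M) := by
  refine subsingleton_of_forall_eq 0 fun x => ?_
  rw [← map_id x, show 𝟙 M = 0 from ModuleCat.hom_ext (LinearMap.ext fun y =>
    Subsingleton.elim _ _), zero_map]

/-- If `a ∈ J` is regular on `M`, then `H^{i + 1}(M)` vanishes as soon as `H^i(M / aM)` does. -/
lemma subsingleton_succ_of_shortExact {a : R} (ha : a ∈ J)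
    (g : M ⟶ N) (w : (a • 𝟙 M) ≫ g = 0) (hS : (ShortComplex.mk _ g w).ShortExact)
    (i : ℕ) [h : Subsingleton (LocCoh J i N)] : Subsingleton (LocCoh J (i + 1) M) := by
  refine subsingleton_of_smul_injective ha fun x hx => ?_
  rw [← map_smul_id] at hx
  obtain ⟨y, rfl⟩ := exists_of_map_f_eq_zero hS rfl x hx
  rw [h.elim y 0, map_zero]

end LocCoh

end

/-! ### Identification of `LocCoh` with the functor `localCohomology`. -/

noncomputable section

open CategoryTheory

namespace LocCoh

variable {R : Type u} [CommRing R] {J : Ideal R} {i : ℕ} {M N K : ModuleCat.{u} R}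

/-- The map `Ext^i(R / J ^ n, M) → H^i_J(M)` into the local cohomology of Mathlib. -/
def toLocalCohomology (J : Ideal R) (i : ℕ) (M : ModuleCat.{u} R) (n : ℕ) :
    Abelian.Ext (J.powQuot n) M i →ₗ[R] (localCohomology J i).obj M :=
  (((Limits.colimit.ι (localCohomology.diagram (localCohomology.idealPowersDiagram J) i)
    (.op (.op n))).app M).hom).comp (Abelian.Ext.derivedEquiv (J.powQuot n) M i).toLinearMap

lemma toLocalCohomology_transition {n m : ℕ} (h : n ≤ m) (x : Abelian.Ext (J.powQuot n) M i) :
    toLocalCohomology J i M m ((Abelian.Ext.mk₀ (J.powQuotMap h)).comp x (zero_add i)) =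
      toLocalCohomology J i M n x := by
  let f : (Opposite.op (Opposite.op n) : (ℕᵒᵖ)ᵒᵖ) ⟶ .op (.op m) := (homOfLE h).op.op
  have h1 := congrArg (fun t => (t.app M).hom (Abelian.Ext.derivedEquiv (J.powQuot n) M i x))
    (Limits.colimit.w (localCohomology.diagram (localCohomology.idealPowersDiagram J) i) f)
  refine (congrArg _ (Abelian.Ext.derivedEquiv_mk₀_comp (J.powQuotMap h) i x)).trans h1

/-- The comparison map with the local cohomology of Mathlib. -/
def toFunctor (J : Ideal R) (i : ℕ) (M : ModuleCat.{u} R) :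
    LocCoh J i M →ₗ[R] (localCohomology J i).obj M :=
  Module.DirectLimit.lift R ℕ _ (extTransition J i M) (toLocalCohomology J i M)
    (fun n m hnm x => by rw [extTransition_apply, toLocalCohomology_transition])

@[simp]
lemma toFunctor_of (n : ℕ) (x : Abelian.Ext (J.powQuot n) M i) :
    toFunctor J i M (of n x) = toLocalCohomology J i M n x :=
  Module.DirectLimit.lift_of (f := extTransition J i M) _ _ x

lemma toFunctor_map (f : M ⟶ N) (x : LocCoh J i M) :
    toFunctor J i N (map f x) = ((localCohomology J i).map f).hom (toFunctor J i M x) := by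
  obtain ⟨n, x, rfl⟩ := exists_of x
  rw [comp_of, toFunctor_of, toFunctor_of]
  have h1 := congrArg (fun t => t.hom (Abelian.Ext.derivedEquiv (J.powQuot n) M i x))
    ((Limits.colimit.ι (localCohomology.diagram (localCohomology.idealPowersDiagram J) i)
      (.op (.op n))).naturality f)
  exact (congrArg _ (Abelian.Ext.derivedEquiv_comp_mk₀ f i x)).trans h1

/-- Evaluation at `M` preserves the colimit of functors, and the forgetful functor preserves
filtered colimits. So elements of the target come from finite stages and equalities hold at finite
stages, just as in the direct limit. -/
lemma toFunctor_bijective (J : Ideal R) (i : ℕ) (M : ModuleCat.{u} R) :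
    Function.Bijective (toFunctor J i M) := by
  let D := localCohomology.diagram (localCohomology.idealPowersDiagram J) i
  let c := ((evaluation _ (ModuleCat.{u} R)).obj M).mapCocone (Limits.colimit.cocone D)
  have hc : Limits.IsColimit c := Limits.isColimitOfPreserves _ (Limits.colimit.isColimit D)
  have : Limits.PreservesFilteredColimitsOfSize.{u, u} (forget (ModuleCat.{u} R)) := inferInstance
  -- The index category `ℕ` lives in universe `0`, not `u`.
  have : Limits.PreservesFilteredColimitsOfSize.{0, 0} (forget (ModuleCat.{u} R)) :=
    Limits.preservesFilteredColimitsOfSize_shrink.{0, u, 0, u} _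
  constructor
  · rw [injective_iff_map_eq_zero]
    intro x hx
    obtain ⟨n, x, rfl⟩ := exists_of x
    rw [toFunctor_of] at hx
    have h0 : (c.ι.app (.op (.op n))).hom (Abelian.Ext.derivedEquiv (J.powQuot n) M i x) =
        (c.ι.app (.op (.op n))).hom 0 := hx.trans (map_zero _).symm
    obtain ⟨k, f, g, hk⟩ := (Limits.Concrete.isColimit_rep_eq_iff_exists _ hc _ _).1 h0
    have hnk : n ≤ k.unop.unop := leOfHom f.unop.unop
    refine of_eq_zero_iff.2 ⟨k.unop.unop, hnk,
      (Abelian.Ext.derivedEquiv (J.powQuot k.unop.unop) M i).injective ?_⟩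
    rw [Abelian.Ext.derivedEquiv_mk₀_comp, map_zero]
    exact hk.trans (map_zero (((D ⋙ (evaluation _ (ModuleCat.{u} R)).obj M).map g).hom))
  · intro y
    obtain ⟨n, y, rfl⟩ := Limits.Concrete.isColimit_exists_rep _ hc y
    obtain ⟨x, rfl⟩ := (Abelian.Ext.derivedEquiv (J.powQuot n.unop.unop) M i).surjective y
    exact ⟨of n.unop.unop x, toFunctor_of _ _⟩

/-- Local cohomology in the sense of Mathlib agrees with `LocCoh`. -/
def equivFunctor (J : Ideal R) (i : ℕ) (M : ModuleCat.{u} R) :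
    LocCoh J i M ≃ₗ[R] (localCohomology J i).obj M :=
  LinearEquiv.ofBijective (toFunctor J i M) (toFunctor_bijective J i M)

lemma equivFunctor_map (f : M ⟶ N) (x : LocCoh J i M) :
    equivFunctor J i N (map f x) = ((localCohomology J i).map f).hom (equivFunctor J i M x) :=
  toFunctor_map f x

lemma localCohomology_map_eq_zero_iff (f : M ⟶ N) :
    (localCohomology J i).map f = 0 ↔ ∀ x : LocCoh J i M, map f x = 0 := by
  constructor
  · intro h x
    apply (equivFunctor J i N).injective
    rw [equivFunctor_map, h, map_zero]
    rfl
  · intro h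
    refine ModuleCat.hom_ext (LinearMap.ext fun y => ?_)
    obtain ⟨x, rfl⟩ := (equivFunctor J i M).surjective y
    rw [← equivFunctor_map, h, map_zero]
    rfl

end LocCoh

end

/-! ### Power torsion modules and vanishing of local cohomology above the dimension. -/

noncomputable section

open CategoryTheory

section PowTorsion

variable {R : Type u} [CommRing R] (J : Ideal R)

/-- The submodule of elements killed by a power of `J`. -/
def Ideal.powTorsion (M : Type u) [AddCommGroup M] [Module R M] : Submodule R M where
  carrier := {x | ∃ n : ℕ, ∀ a ∈ J ^ n, a • x = 0}
  add_mem' := by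
    rintro x y ⟨n, hn⟩ ⟨m, hm⟩
    refine ⟨max n m, fun a ha => ?_⟩
    rw [smul_add, hn a (Ideal.pow_le_pow_right (le_max_left _ _) ha),
      hm a (Ideal.pow_le_pow_right (le_max_right _ _) ha), add_zero]
  zero_mem' := ⟨0, fun a _ => smul_zero a⟩
  smul_mem' := by
    rintro c x ⟨n, hn⟩
    exact ⟨n, fun a ha => by rw [smul_comm, hn a ha, smul_zero]⟩

variable {J}

lemma Ideal.exists_forall_smul_eq_zero_of_fg {M : Type u} [AddCommGroup M] [Module R M]
    {N : Submodule R M} (hN : N.FG) (h : N ≤ J.powTorsion M) :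
    ∃ n : ℕ, ∀ a ∈ J ^ n, ∀ x ∈ N, a • x = 0 := by
  induction N, hN using Submodule.fg_induction with
  | singleton x =>
    obtain ⟨n, hn⟩ := h (Submodule.mem_span_singleton_self x)
    refine ⟨n, fun a ha y hy => ?_⟩
    obtain ⟨c, rfl⟩ := Submodule.mem_span_singleton.1 hy
    rw [smul_comm, hn a ha, smul_zero]
  | sup N₁ N₂ _ _ h₁ h₂ =>
    obtain ⟨n, hn⟩ := h₁ (le_sup_left.trans h)
    obtain ⟨m, hm⟩ := h₂ (le_sup_right.trans h)
    refine ⟨max n m, fun a ha x hx => ?_⟩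
    obtain ⟨y, hy, z, hz, rfl⟩ := Submodule.mem_sup.1 hx
    rw [smul_add, hn a (Ideal.pow_le_pow_right (le_max_left _ _) ha) y hy,
      hm a (Ideal.pow_le_pow_right (le_max_right _ _) ha) z hz, add_zero]

/-- Over a Noetherian ring, the `J`-power torsion of an injective module is injective. -/
lemma Ideal.injective_powTorsion [IsNoetherianRing R] (E : Type u) [AddCommGroup E] [Module R E]
    [Module.Injective R E] : Module.Injective R (J.powTorsion E) := by
  apply Module.Baer.injective
  intro I g
  have hI : I.FG := IsNoetherian.noetherian I
  let f : I →ₗ[R] E := (J.powTorsion E).subtype.comp g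
  obtain ⟨n, hn⟩ : ∃ n : ℕ, ∀ a ∈ J ^ n, ∀ x ∈ LinearMap.range f, a • x = 0 := by
    have : Module.Finite R I := Module.Finite.iff_fg.2 hI
    refine Ideal.exists_forall_smul_eq_zero_of_fg
      (by rw [LinearMap.range_eq_map]; exact Module.Finite.fg_top.map f) ?_
    rintro _ ⟨x, rfl⟩
    exact (g x).2
  -- Artin–Rees: `I ∩ J ^ (n + k) ⊆ J ^ n I`, and `f` vanishes on the latter. Hence `f` factors
  -- through the image of `I` in `R / J ^ (n + k)`, and any extension from that quotient has power
  -- torsion values.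
  obtain ⟨k, hk⟩ := J.exists_pow_inf_eq_pow_smul (M := R) I
  have hk' := hk (n + k) (Nat.le_add_left k n)
  let q : I →ₗ[R] (R ⧸ J ^ (n + k)) := (J ^ (n + k)).mkQ.comp I.subtype
  have hq : LinearMap.ker q ≤ LinearMap.ker f := by
    intro x hx
    have hx1 : (x : R) ∈ J ^ (n + k) := (Submodule.Quotient.mk_eq_zero _).1 hx
    have hx2 : (x : R) ∈ J ^ n • (I : Submodule R R) := by
      have : (x : R) ∈ J ^ (n + k) • (⊤ : Submodule R R) ⊓ I :=
        ⟨by simpa using hx1, x.2⟩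
      rw [hk', Nat.add_sub_cancel] at this
      exact Submodule.smul_mono le_rfl inf_le_right this
    have key : ∀ y (_ : y ∈ J ^ n • (I : Submodule R R)) (hy : y ∈ I), f ⟨y, hy⟩ = 0 := by
      intro y hy
      induction hy using Submodule.smul_induction_on' with
      | smul r hr z hz =>
        intro hy
        have : (⟨r • z, hy⟩ : I) = r • ⟨z, hz⟩ := rfl
        rw [this, map_smul, hn r hr _ ⟨_, rfl⟩]
      | add y hy z hz h₁ h₂ =>
        intro hyz
        have hy' : y ∈ I := Submodule.smul_le_right hy
        have hz' : z ∈ I := Submodule.smul_le_right hz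
        have : (⟨y + z, hyz⟩ : I) = ⟨y, hy'⟩ + ⟨z, hz'⟩ := rfl
        rw [this, map_add, h₁ hy', h₂ hz', add_zero]
    exact key _ hx2 x.2
  let f' : LinearMap.range q →ₗ[R] E :=
    ((LinearMap.ker q).liftQ f hq).comp q.quotKerEquivRange.symm.toLinearMap
  have hf' : ∀ x, f' ⟨q x, x, rfl⟩ = f x := by
    intro x
    have : q.quotKerEquivRange (Submodule.Quotient.mk x) = ⟨q x, x, rfl⟩ := rfl
    rw [← this, LinearMap.comp_apply, LinearEquiv.coe_coe, LinearEquiv.symm_apply_apply,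
      Submodule.liftQ_apply]
  obtain ⟨h, hh⟩ := Module.Injective.out (LinearMap.range q).subtype
    (Submodule.subtype_injective _) f'
  refine ⟨(h.comp (J ^ (n + k)).mkQ).codRestrict (J.powTorsion E) fun y =>
    ⟨n + k, fun a ha => ?_⟩, fun x hx => Subtype.ext ?_⟩
  · rw [← map_smul]
    have : a • y ∈ J ^ (n + k) := Ideal.mul_mem_right _ _ ha
    rw [LinearMap.comp_apply, Submodule.mkQ_apply, (Submodule.Quotient.mk_eq_zero _).2 this,
      map_zero]
  · exact (hh ⟨q ⟨x, hx⟩, ⟨x, hx⟩, rfl⟩).trans (hf' ⟨x, hx⟩)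

end PowTorsion

/-- A short exact sequence of modules as a short exact sequence in the category of modules. -/
lemma ModuleCat.shortExact_of_linearMap {R : Type u} [Ring R] {A B C : Type u} [AddCommGroup A]
    [Module R A] [AddCommGroup B] [Module R B] [AddCommGroup C] [Module R C] (f : A →ₗ[R] B)
    (g : B →ₗ[R] C) (hf : Function.Injective f) (hfg : Function.Exact f g)
    (hg : Function.Surjective g) (w : ModuleCat.ofHom f ≫ ModuleCat.ofHom g = 0) :
    (ShortComplex.mk (ModuleCat.ofHom f) (ModuleCat.ofHom g) w).ShortExact where
  exact := (ShortComplex.ShortExact.moduleCat_exact_iff_function_exact _).mpr hfg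
  mono_f := (ModuleCat.mono_iff_injective _).2 hf
  epi_g := (ModuleCat.epi_iff_surjective _).2 hg

lemma ModuleCat.ofHom_comp_eq_zero {R : Type u} [Ring R] {A B C : Type u} [AddCommGroup A]
    [Module R A] [AddCommGroup B] [Module R B] [AddCommGroup C] [Module R C] {f : A →ₗ[R] B}
    {g : B →ₗ[R] C} (hfg : Function.Exact f g) : ModuleCat.ofHom f ≫ ModuleCat.ofHom g = 0 :=
  ModuleCat.hom_ext hfg.linearMap_comp_eq_zero

namespace LocCoh

variable {R : Type u} [CommRing R] {J : Ideal R}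

lemma subsingleton_of_injective (M : ModuleCat.{u} R) [Injective M] (i : ℕ) :
    Subsingleton (LocCoh J (i + 1) M) := by
  refine subsingleton_of_forall_eq 0 fun x => ?_
  obtain ⟨n, x, rfl⟩ := exists_of x
  rw [Abelian.Ext.eq_zero_of_injective x, map_zero]

/-- On `J`-power torsion modules, `H^0_J` preserves surjections. -/
lemma map_surjective_of_powTorsion {M N : ModuleCat.{u} R} (g : M ⟶ N)
    (hg : Function.Surjective g.hom) (hM : J.powTorsion M = ⊤) :
    Function.Surjective (map g : LocCoh J 0 M →ₗ[R] LocCoh J 0 N) := by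
  intro y
  obtain ⟨n, y, rfl⟩ := exists_of y
  obtain ⟨y, rfl⟩ := (Abelian.Ext.mk₀_bijective _ _).2 y
  -- A map out of `R / J ^ n` is determined by the image of `1`. A lift `u` of that image may need a
  -- higher power of `J` to kill it, which is absorbed by passing to stage `max n m`.
  obtain ⟨u, hu⟩ := hg (y.hom (Submodule.Quotient.mk 1))
  obtain ⟨m, hm⟩ : u ∈ J.powTorsion M := hM ▸ trivial
  let f : J.powQuot (max n m) ⟶ M := ModuleCat.ofHom
    (Submodule.liftQ _ (LinearMap.toSpanSingleton R M u) fun a ha =>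
      hm a (Ideal.pow_le_pow_right (le_max_right n m) ha))
  refine ⟨of (max n m) (Abelian.Ext.mk₀ f), ?_⟩
  rw [comp_of, ← of_transition (le_max_left n m), Abelian.Ext.mk₀_comp_mk₀,
    Abelian.Ext.mk₀_comp_mk₀]
  congr 2
  refine ModuleCat.hom_ext (Submodule.linearMap_qext _ (LinearMap.ext_ring ?_))
  have : f.hom (Submodule.Quotient.mk 1) = u := one_smul R u
  exact (congrArg g.hom this).trans hu

/-- A `J`-power torsion module embeds into an injective `J`-power torsion module. -/
lemma exists_shortExact_powTorsion [IsNoetherianRing R] (M : ModuleCat.{u} R)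
    (hM : J.powTorsion M = ⊤) :
    ∃ (G N : ModuleCat.{u} R) (f : M ⟶ G) (g : G ⟶ N) (w : f ≫ g = 0),
      (ShortComplex.mk f g w).ShortExact ∧ Injective G ∧ J.powTorsion G = ⊤ ∧
        J.powTorsion N = ⊤ := by
  let E : ModuleCat.{u} R := Injective.under M
  have : Injective (ModuleCat.of R E) := inferInstanceAs (Injective (Injective.under M))
  have : Module.Injective R E := Module.injective_module_of_injective_object _ _
  have := Ideal.injective_powTorsion (J := J) E
  let f : M →ₗ[R] J.powTorsion E :=
    (Injective.ι M).hom.codRestrict _ fun x => by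
      obtain ⟨n, hn⟩ : x ∈ J.powTorsion M := hM ▸ trivial
      exact ⟨n, fun a ha => by rw [← map_smul, hn a ha, map_zero]⟩
  have hf : Function.Injective f := fun x y h =>
    (ModuleCat.mono_iff_injective _).1 (inferInstance : Mono (Injective.ι M))
      (congrArg Subtype.val h)
  have hex : Function.Exact f (LinearMap.range f).mkQ :=
    LinearMap.exact_iff.2 (Submodule.ker_mkQ _)
  have hG : J.powTorsion (J.powTorsion E) = ⊤ := by
    refine eq_top_iff.2 fun x _ => ?_
    obtain ⟨n, hn⟩ := x.2
    exact ⟨n, fun a ha => Subtype.ext (hn a ha)⟩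
  refine ⟨ModuleCat.of R (J.powTorsion E), ModuleCat.of R (_ ⧸ LinearMap.range f),
    ModuleCat.ofHom f, ModuleCat.ofHom (LinearMap.range f).mkQ,
    ModuleCat.ofHom_comp_eq_zero hex,
    ModuleCat.shortExact_of_linearMap _ _ hf hex (Submodule.mkQ_surjective _) _,
    Module.injective_object_of_injective_module _ _, hG, ?_⟩
  refine eq_top_iff.2 fun x _ => ?_
  obtain ⟨x, rfl⟩ := Submodule.mkQ_surjective _ x
  obtain ⟨n, hn⟩ : x ∈ J.powTorsion (J.powTorsion E) := hG ▸ trivial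
  exact ⟨n, fun a ha => by rw [← map_smul, hn a ha, map_zero]⟩

/-- The higher local cohomology of `J`-power torsion modules vanishes. -/
lemma subsingleton_succ_of_powTorsion [IsNoetherianRing R] (i : ℕ) (M : ModuleCat.{u} R)
    (hM : J.powTorsion M = ⊤) : Subsingleton (LocCoh J (i + 1) M) := by
  induction i generalizing M with
  | zero =>
    obtain ⟨G, N, f, g, w, hS, hG, hG', -⟩ := exists_shortExact_powTorsion M hM
    refine subsingleton_of_forall_eq 0 fun x => ?_
    -- The class is `δ y`. Since `G` is power torsion, `y` lifts to `H^0(G)`, so `δ y = 0`.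
    obtain ⟨y, rfl⟩ := exists_of_map_f_eq_zero hS rfl x
      ((subsingleton_of_injective G 0).elim _ _)
    obtain ⟨z, rfl⟩ := map_surjective_of_powTorsion g
      ((ModuleCat.epi_iff_surjective _).1 hS.epi_g) hG' y
    exact δ_map_g hS rfl z
  | succ i ih =>
    obtain ⟨G, N, f, g, w, hS, hG, -, hN⟩ := exists_shortExact_powTorsion M hM
    refine subsingleton_of_forall_eq 0 fun x => ?_
    obtain ⟨y, rfl⟩ := exists_of_map_f_eq_zero hS rfl x
      ((subsingleton_of_injective G (i + 1)).elim _ _)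
    rw [(ih N hN).elim y 0, map_zero]

/-- Local cohomology of an extension vanishes if that of both factors does. -/
lemma subsingleton_of_shortExact {S : ShortComplex (ModuleCat.{u} R)} (hS : S.ShortExact) {i : ℕ}
    (h₁ : Subsingleton (LocCoh J i S.X₁)) (h₃ : Subsingleton (LocCoh J i S.X₃)) :
    Subsingleton (LocCoh J i S.X₂) := by
  refine subsingleton_of_forall_eq 0 fun x => ?_
  obtain ⟨y, rfl⟩ := exists_of_map_g_eq_zero hS x (h₃.elim _ _)
  rw [h₁.elim y 0, map_zero]

lemma subsingleton_of_linearEquiv {M N : Type u} [AddCommGroup M] [Module R M] [AddCommGroup N]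
    [Module R N] (e : M ≃ₗ[R] N) {i : ℕ} (h : Subsingleton (LocCoh J i (ModuleCat.of R N))) :
    Subsingleton (LocCoh J i (ModuleCat.of R M)) := by
  refine subsingleton_of_forall_eq 0 fun x => ?_
  have h1 : ModuleCat.ofHom e.toLinearMap ≫ ModuleCat.ofHom e.symm.toLinearMap = 𝟙 _ :=
    ModuleCat.hom_ext (LinearMap.ext fun y => e.symm_apply_apply y)
  rw [← map_id x, ← h1, ← map_map, h.elim (map _ x) 0, map_zero]

/-- Vanishing of local cohomology above the dimension for finitely generated modules. -/
lemma subsingleton_of_ringKrullDim_lt [IsNoetherianRing R] (n : ℕ) (I : Ideal R)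
    (hI : ringKrullDim (R ⧸ I) < n) (i : ℕ) (hi : n ≤ i) :
    Subsingleton (LocCoh J i (ModuleCat.of R (R ⧸ I))) := by
  induction n generalizing I i with
  | zero =>
    have : Subsingleton (R ⧸ I) := by
      by_contra h
      rw [not_subsingleton_iff_nontrivial] at h
      exact absurd ringKrullDim_nonneg_of_nontrivial (not_le.2 hI)
    exact subsingleton_of_subsingleton (ModuleCat.of R (R ⧸ I)) i
  | succ n ih =>
    obtain ⟨i, rfl⟩ : ∃ j, i = j + 1 := ⟨i - 1, by omega⟩
    -- A prime filtration passes through arbitrary finite modules; the condition on the annihilator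
    -- keeps every prime of the filtration above `I`, so that the dimension bound is inherited.
    suffices H : ∀ (N : Type u) [AddCommGroup N] [Module R N] [Module.Finite R N],
        I ≤ Module.annihilator R N → Subsingleton (LocCoh J (i + 1) (ModuleCat.of R N)) from
      H _ (by rw [Ideal.annihilator_quotient])
    intro N _ _ hN
    induction hN using IsNoetherianRing.induction_on_isQuotientEquivQuotientPrime R with
    | subsingleton N => exact fun _ => subsingleton_of_subsingleton (ModuleCat.of R N) _
    | quotient N p e =>
      intro hp
      rw [e.annihilator_eq, Ideal.annihilator_quotient] at hp
      refine subsingleton_of_linearEquiv e ?_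
      -- If `J ⊆ p`, then `R / p` is power torsion. Otherwise some `a ∈ J` is regular on `R / p`,
      -- and dividing by it lowers both the dimension and the cohomological degree by one.
      by_cases hJ : J ≤ p.asIdeal
      · refine subsingleton_succ_of_powTorsion i _ (eq_top_iff.2 fun x _ => ⟨1, fun a ha => ?_⟩)
        obtain ⟨x, rfl⟩ := Submodule.Quotient.mk_surjective _ x
        rw [pow_one] at ha
        exact (Submodule.Quotient.mk_eq_zero _).2 (Ideal.mul_mem_right _ _ (hJ ha))
      · obtain ⟨a, ha, hap⟩ := SetLike.not_le_iff_exists.1 hJ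
        let q := p.asIdeal ⊔ Ideal.span {a}
        let g : (R ⧸ p.asIdeal) →ₗ[R] (R ⧸ q) := Submodule.factor le_sup_left
        have hf : Function.Injective (a • LinearMap.id : (R ⧸ p.asIdeal) →ₗ[R] (R ⧸ p.asIdeal)) := by
          rw [injective_iff_map_eq_zero]
          intro x hx
          obtain ⟨x, rfl⟩ := Submodule.Quotient.mk_surjective _ x
          have : a * x ∈ p.asIdeal := (Submodule.Quotient.mk_eq_zero _).1 hx
          exact (Submodule.Quotient.mk_eq_zero _).2 ((p.2.mem_or_mem this).resolve_left hap)
        have hex : Function.Exact (a • LinearMap.id : (R ⧸ p.asIdeal) →ₗ[R] (R ⧸ p.asIdeal)) g := by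
          intro x
          obtain ⟨x, rfl⟩ := Submodule.Quotient.mk_surjective _ x
          constructor
          · intro hx
            have : x ∈ q := (Submodule.Quotient.mk_eq_zero _).1 hx
            obtain ⟨y, hy, z, hz, rfl⟩ := Submodule.mem_sup.1 this
            obtain ⟨c, rfl⟩ := Ideal.mem_span_singleton'.1 hz
            refine ⟨Submodule.Quotient.mk c, (Submodule.Quotient.eq _).2 ?_⟩
            have : a * c - (y + c * a) = - y := by ring
            change a * c - (y + c * a) ∈ p.asIdeal
            rw [this]
            exact neg_mem hy
          · rintro ⟨y, hy⟩
            obtain ⟨y, rfl⟩ := Submodule.Quotient.mk_surjective _ y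
            rw [← hy]
            exact (Submodule.Quotient.mk_eq_zero _).2
              (Ideal.mem_sup_right (Ideal.mem_span_singleton'.2 ⟨y, mul_comm _ _⟩))
        have hdim : ringKrullDim (R ⧸ q) < n := by
          have h1 : ringKrullDim (R ⧸ q) + 1 ≤ ringKrullDim (R ⧸ p.asIdeal) := by
            refine ringKrullDim_succ_le_of_surjective (Ideal.Quotient.factor le_sup_left)
              (Ideal.Quotient.factor_surjective _) (r := Ideal.Quotient.mk _ a) ?_ ?_
            · rw [mem_nonZeroDivisors_iff_ne_zero]
              exact fun h => hap (Ideal.Quotient.eq_zero_iff_mem.1 h)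
            · exact Ideal.Quotient.eq_zero_iff_mem.2
                (Ideal.mem_sup_right (Ideal.mem_span_singleton_self a))
          have h2 : ringKrullDim (R ⧸ p.asIdeal) ≤ ringKrullDim (R ⧸ I) :=
            ringKrullDim_le_of_surjective (Ideal.Quotient.factor hp)
              (Ideal.Quotient.factor_surjective _)
          have h3 := (h1.trans h2).trans_lt hI
          rw [Nat.cast_add, Nat.cast_one] at h3
          exact lt_of_add_lt_add_right h3
        have := ih q hdim i (by omega)
        exact subsingleton_succ_of_shortExact ha (ModuleCat.ofHom g)
          (ModuleCat.ofHom_comp_eq_zero hex)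
          (ModuleCat.shortExact_of_linearMap _ _ hf hex (Submodule.factor_surjective _) _) i
    | exact N₁ N₂ N₃ f g hf hg hfg h₁ h₃ =>
      intro hN
      have h1 := h₁ (hN.trans (LinearMap.annihilator_le_of_injective f hf))
      have h3 := h₃ (hN.trans (LinearMap.annihilator_le_of_surjective g hg))
      exact subsingleton_of_shortExact (ModuleCat.shortExact_of_linearMap f g hf hfg hg
        (ModuleCat.ofHom_comp_eq_zero hfg)) h1 h3

end LocCoh

end

/-! ### Local cohomology of the polynomial ring and of its proper quotients. -/

noncomputable section

open CategoryTheory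

namespace FiberFull

section PolynomialRing

variable {r : ℕ} {k : Type u} [Field k]

/-- The ideal `(x_0, …, x_{n-1})`. -/
def firstVarsIdeal (r : ℕ) (k : Type u) [Field k] (n : ℕ) : Ideal (PolyRing r k) :=
  Ideal.span (MvPolynomial.X '' {j : Fin (r + 1) | (j : ℕ) < n})

lemma mem_firstVarsIdeal {n : ℕ} {f : PolyRing r k} :
    f ∈ firstVarsIdeal r k n ↔ ∀ m ∈ f.support, ∃ j : Fin (r + 1), (j : ℕ) < n ∧ m j ≠ 0 :=
  MvPolynomial.mem_ideal_span_X_image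

/-- Membership in a monomial ideal is read off the support. Multiplication by `x_n` shifts exponents
only in a variable outside the generators, so `x_n` is regular modulo `(x_0, …, x_{n-1})`. -/
lemma mem_firstVarsIdeal_of_X_mul_mem {n : ℕ} {j : Fin (r + 1)} (hj : (j : ℕ) = n)
    {f : PolyRing r k} (h : MvPolynomial.X j * f ∈ firstVarsIdeal r k n) :
    f ∈ firstVarsIdeal r k n := by
  rw [mem_firstVarsIdeal] at h ⊢
  intro m hm
  obtain ⟨l, hl, hml⟩ := h (Finsupp.single j 1 + m) (by
    rw [MvPolynomial.mem_support_iff, MvPolynomial.coeff_X_mul]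
    exact MvPolynomial.mem_support_iff.1 hm)
  refine ⟨l, hl, ?_⟩
  have hlj : j ≠ l := by
    rintro rfl
    omega
  simpa [Finsupp.single_eq_of_ne' hlj] using hml

lemma X_mem_irrelevantIdeal (j : Fin (r + 1)) :
    (MvPolynomial.X j : PolyRing r k) ∈ irrelevantIdeal r k :=
  Ideal.subset_span ⟨j, rfl⟩

lemma firstVarsIdeal_le_succ (n : ℕ) : firstVarsIdeal r k n ≤ firstVarsIdeal r k (n + 1) :=
  Ideal.span_mono (Set.image_mono fun _ h => Nat.lt_succ_of_lt h)

lemma mem_firstVarsIdeal_succ {n : ℕ} {j : Fin (r + 1)} (hj : (j : ℕ) = n) {f : PolyRing r k} :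
    f ∈ firstVarsIdeal r k (n + 1) ↔ ∃ c, MvPolynomial.X j * c - f ∈ firstVarsIdeal r k n := by
  have h : firstVarsIdeal r k (n + 1) =
      firstVarsIdeal r k n ⊔ Ideal.span {(MvPolynomial.X j : PolyRing r k)} := by
    rw [firstVarsIdeal, firstVarsIdeal, ← Ideal.span_union, ← Set.image_singleton,
      ← Set.image_union]
    congr 2
    ext l
    simp only [Set.mem_ofPred_eq, Set.mem_union, Set.mem_singleton_iff, Fin.ext_iff]
    omega
  rw [h]
  constructor
  · intro hf
    obtain ⟨y, hy, z, hz, rfl⟩ := Submodule.mem_sup.1 hf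
    obtain ⟨c, rfl⟩ := Ideal.mem_span_singleton'.1 hz
    refine ⟨c, ?_⟩
    rw [show MvPolynomial.X j * c - (y + c * MvPolynomial.X j) = -y by ring]
    exact neg_mem hy
  · rintro ⟨c, hc⟩
    have : f = c * MvPolynomial.X j - (MvPolynomial.X j * c - f) := by ring
    rw [this]
    exact sub_mem (Ideal.mem_sup_right (Ideal.mem_span_singleton'.2 ⟨c, rfl⟩))
      (Ideal.mem_sup_left hc)

/-- The variables form a regular sequence. In degree `0` the regular element `x_n` acts injectively
on a module on which it is locally nilpotent; in degree `i + 1`, dividing by `x_n` reduces to degree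
`i` with one more variable. The bound guarantees that `x_n` exists. -/
lemma subsingleton_locCoh_quotient_firstVarsIdeal (i n : ℕ) (h : i + n < r + 1) :
    Subsingleton (LocCoh (irrelevantIdeal r k) i
      (ModuleCat.of (PolyRing r k) (PolyRing r k ⧸ firstVarsIdeal r k n))) := by
  induction i generalizing n with
  | zero =>
    let j : Fin (r + 1) := ⟨n, by omega⟩
    refine LocCoh.subsingleton_of_smul_injective (X_mem_irrelevantIdeal j) fun x hx => ?_
    have : Mono ((MvPolynomial.X j : PolyRing r k) •
        𝟙 (ModuleCat.of (PolyRing r k) (PolyRing r k ⧸ firstVarsIdeal r k n))) := by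
      rw [ModuleCat.mono_iff_injective, injective_iff_map_eq_zero]
      intro y hy
      obtain ⟨y, rfl⟩ := Submodule.Quotient.mk_surjective _ y
      exact (Submodule.Quotient.mk_eq_zero _).2
        (mem_firstVarsIdeal_of_X_mul_mem (j := j) rfl ((Submodule.Quotient.mk_eq_zero _).1 hy))
    refine LocCoh.map_injective_of_mono ((MvPolynomial.X j : PolyRing r k) • 𝟙 _) ?_
    rw [LocCoh.map_smul_id, hx, map_zero]
  | succ i ih =>
    let j : Fin (r + 1) := ⟨n, by omega⟩
    let g : (PolyRing r k ⧸ firstVarsIdeal r k n) →ₗ[PolyRing r k]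
      (PolyRing r k ⧸ firstVarsIdeal r k (n + 1)) := Submodule.factor (firstVarsIdeal_le_succ n)
    have hf : Function.Injective ((MvPolynomial.X j : PolyRing r k) • LinearMap.id :
        (PolyRing r k ⧸ firstVarsIdeal r k n) →ₗ[PolyRing r k] _) := by
      rw [injective_iff_map_eq_zero]
      intro y hy
      obtain ⟨y, rfl⟩ := Submodule.Quotient.mk_surjective _ y
      exact (Submodule.Quotient.mk_eq_zero _).2
        (mem_firstVarsIdeal_of_X_mul_mem (j := j) rfl ((Submodule.Quotient.mk_eq_zero _).1 hy))
    have hex : Function.Exact ((MvPolynomial.X j : PolyRing r k) • LinearMap.id :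
        (PolyRing r k ⧸ firstVarsIdeal r k n) →ₗ[PolyRing r k] _) g := by
      intro x
      obtain ⟨x, rfl⟩ := Submodule.Quotient.mk_surjective _ x
      refine ((Submodule.Quotient.mk_eq_zero _).trans
        (mem_firstVarsIdeal_succ (j := j) rfl)).trans ?_
      constructor
      · rintro ⟨c, hc⟩
        exact ⟨Submodule.Quotient.mk c, (Submodule.Quotient.eq _).2 hc⟩
      · rintro ⟨y, hy⟩
        obtain ⟨y, rfl⟩ := Submodule.Quotient.mk_surjective _ y
        exact ⟨y, (Submodule.Quotient.eq _).1 hy⟩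
    have := ih (n + 1) (by omega)
    exact LocCoh.subsingleton_succ_of_shortExact (X_mem_irrelevantIdeal j) (ModuleCat.ofHom g)
      (ModuleCat.ofHom_comp_eq_zero hex)
      (ModuleCat.shortExact_of_linearMap _ _ hf hex (Submodule.factor_surjective _) _) i

/-- The local cohomology of the polynomial ring vanishes below the number of variables. -/
lemma subsingleton_locCoh_polyRing (i : ℕ) (h : i < r + 1) :
    Subsingleton (LocCoh (irrelevantIdeal r k) i (ModuleCat.of (PolyRing r k) (PolyRing r k))) :=
  LocCoh.subsingleton_of_linearEquiv
    (Submodule.quotEquivOfEqBot (firstVarsIdeal r k 0) (by simp [firstVarsIdeal])).symm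
    (subsingleton_locCoh_quotient_firstVarsIdeal i 0 h)

/-- The local cohomology of a proper quotient of the polynomial ring vanishes from the number of
variables on. -/
lemma subsingleton_locCoh_quotient {I : Ideal (PolyRing r k)} (hI : I ≠ ⊥) (i : ℕ)
    (h : r + 1 ≤ i) :
    Subsingleton (LocCoh (irrelevantIdeal r k) i
      (ModuleCat.of (PolyRing r k) (PolyRing r k ⧸ I))) := by
  refine LocCoh.subsingleton_of_ringKrullDim_lt (r + 1) I ?_ i h
  obtain ⟨f, hf, hf0⟩ := Submodule.exists_mem_ne_zero_of_ne_bot hI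
  -- A nonzero element of `I` is regular in the domain `R`, which has dimension `r + 1`.
  have h1 : ringKrullDim (PolyRing r k ⧸ I) + 1 ≤ ringKrullDim (PolyRing r k) :=
    ringKrullDim_succ_le_of_surjective (Ideal.Quotient.mk I) Ideal.Quotient.mk_surjective
      (mem_nonZeroDivisors_iff_ne_zero.2 hf0) (Ideal.Quotient.eq_zero_iff_mem.2 hf)
  rw [MvPolynomial.ringKrullDim_of_isNoetherianRing, ringKrullDim_eq_zero_of_field, zero_add,
    Nat.card_eq_fintype_card, Fintype.card_fin, Nat.cast_add, Nat.cast_one] at h1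
  have h2 : ringKrullDim (PolyRing r k ⧸ I) ≤ r :=
    ENat.WithBot.add_le_add_natCast_right_iff.mp h1
  exact h2.trans_lt (by exact_mod_cast Nat.lt_succ_self r)

end PolynomialRing

end FiberFull

end

/-! ### Base change of local cohomology along a homomorphism whose restriction of scalars preserves
injectives. -/

noncomputable section

open CategoryTheory

namespace LocCoh

section BaseChange

variable {R S : Type u} [CommRing R] [CommRing S] (f : R →+* S) (J : Ideal R)

/-- The map `R / J ^ n → S / (J S) ^ n`, as a map of `R`-modules. -/
def powQuotBaseChange (n : ℕ) :
    J.powQuot n ⟶ (ModuleCat.restrictScalars f).obj ((J.map f).powQuot n) :=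
  ModuleCat.ofHom (Y := (ModuleCat.restrictScalars f).obj ((J.map f).powQuot n))
    { toFun := Ideal.quotientMap ((J.map f) ^ n) f
        (Ideal.map_le_iff_le_comap.1 (Ideal.map_pow f J n).le)
      map_add' := map_add _
      map_smul' := fun a x => by
        obtain ⟨x, rfl⟩ := Ideal.Quotient.mk_surjective x
        change Ideal.quotientMap _ f _ (Ideal.Quotient.mk _ (a * x)) =
          Ideal.Quotient.mk _ (f a * f x)
        rw [Ideal.quotientMap_mk, map_mul] }

lemma powQuotBaseChange_naturality {n m : ℕ} (h : n ≤ m) :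
    J.powQuotMap h ≫ powQuotBaseChange f J n =
      powQuotBaseChange f J m ≫ (ModuleCat.restrictScalars f).map ((J.map f).powQuotMap h) :=
  ModuleCat.hom_ext (LinearMap.ext fun x => by
    obtain ⟨x, rfl⟩ := Ideal.Quotient.mk_surjective x
    rfl)

/-- The base change map `Ext_S^i(S / (J S) ^ n, M) → Ext_R^i(R / J ^ n, M)`. -/
def extBaseChange (n i : ℕ) (M : ModuleCat.{u} S) :
    Abelian.Ext ((J.map f).powQuot n) M i →+
      Abelian.Ext (J.powQuot n) ((ModuleCat.restrictScalars f).obj M) i where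
  toFun x := (Abelian.Ext.mk₀ (powQuotBaseChange f J n)).comp
    (x.mapExactFunctor (ModuleCat.restrictScalars f)) (zero_add i)
  map_zero' := by rw [Abelian.Ext.mapExactFunctor_zero, Abelian.Ext.comp_zero]
  map_add' x y := by rw [Abelian.Ext.mapExactFunctor_add, Abelian.Ext.comp_add]

variable {f J}

lemma extBaseChange_apply {n i : ℕ} {M : ModuleCat.{u} S}
    (x : Abelian.Ext ((J.map f).powQuot n) M i) :
    extBaseChange f J n i M x = (Abelian.Ext.mk₀ (powQuotBaseChange f J n)).comp
      (x.mapExactFunctor (ModuleCat.restrictScalars f)) (zero_add i) := rfl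

lemma extBaseChange_comp {n i j k : ℕ} {M N : ModuleCat.{u} S}
    (x : Abelian.Ext ((J.map f).powQuot n) M i) (e : Abelian.Ext M N j) (h : i + j = k) :
    extBaseChange f J n k N (x.comp e h) =
      (extBaseChange f J n i M x).comp (e.mapExactFunctor (ModuleCat.restrictScalars f)) h := by
  rw [extBaseChange_apply, extBaseChange_apply, Abelian.Ext.mapExactFunctor_comp,
    Abelian.Ext.comp_assoc _ _ _ _ _ (by omega)]

lemma extBaseChange_transition {n m i : ℕ} (h : n ≤ m) {M : ModuleCat.{u} S}
    (x : Abelian.Ext ((J.map f).powQuot n) M i) :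
    extBaseChange f J m i M
        ((Abelian.Ext.mk₀ ((J.map f).powQuotMap h)).comp x (zero_add i)) =
      (Abelian.Ext.mk₀ (J.powQuotMap h)).comp (extBaseChange f J n i M x) (zero_add i) := by
  rw [extBaseChange_apply, extBaseChange_apply, Abelian.Ext.mapExactFunctor_comp,
    Abelian.Ext.mapExactFunctor_mk₀, Abelian.Ext.mk₀_comp_mk₀_assoc,
    Abelian.Ext.mk₀_comp_mk₀_assoc, powQuotBaseChange_naturality]

/-- Both sides are the elements of `M` killed by `J ^ n`: a map out of a cyclic module is the image
of `1`, and being killed by `J ^ n` is the same as being killed by the ideal it generates in `S`. -/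
lemma extBaseChange_zero_bijective (n : ℕ) (M : ModuleCat.{u} S) :
    Function.Bijective (extBaseChange f J n 0 M) := by
  constructor
  · rw [injective_iff_map_eq_zero]
    intro x hx
    obtain ⟨φ, rfl⟩ := (Abelian.Ext.mk₀_bijective _ _).2 x
    rw [extBaseChange_apply, Abelian.Ext.mapExactFunctor_mk₀, Abelian.Ext.mk₀_comp_mk₀] at hx
    have h0 := (Abelian.Ext.mk₀_bijective _ _).1 (hx.trans (Abelian.Ext.mk₀_zero _ _).symm)
    have h1 : φ = 0 := by
      refine ModuleCat.hom_ext (Submodule.linearMap_qext _ (LinearMap.ext_ring ?_))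
      have h2 := congrArg (fun t => t.hom (Ideal.Quotient.mk _ 1)) h0
      have h3 : φ.hom (Ideal.Quotient.mk _ (f 1)) = 0 := h2
      rw [map_one] at h3
      exact h3
    rw [h1, Abelian.Ext.mk₀_zero]
  · intro y
    obtain ⟨g, rfl⟩ := (Abelian.Ext.mk₀_bijective _ _).2 y
    let u : M := g.hom (Ideal.Quotient.mk _ 1)
    have hu : ∀ a ∈ (J.map f) ^ n, a • u = 0 := by
      intro a ha
      rw [← Ideal.map_pow] at ha
      have hle : (J ^ n).map f ≤ LinearMap.ker (LinearMap.toSpanSingleton S M u) := by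
        refine Ideal.map_le_iff_le_comap.2 fun b hb => ?_
        have h1 : g.hom (b • Ideal.Quotient.mk _ 1) = f b • u := map_smul g.hom b _
        have h2 : (b • Ideal.Quotient.mk (J ^ n) 1) = 0 :=
          Ideal.Quotient.eq_zero_iff_mem.2 (Ideal.mul_mem_right _ _ hb)
        rw [h2, map_zero] at h1
        exact h1.symm
      exact hle ha
    let φ : (J.map f).powQuot n ⟶ M := ModuleCat.ofHom
      (Submodule.liftQ _ (LinearMap.toSpanSingleton S M u) fun a ha => hu a ha)
    refine ⟨Abelian.Ext.mk₀ φ, ?_⟩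
    rw [extBaseChange_apply, Abelian.Ext.mapExactFunctor_mk₀, Abelian.Ext.mk₀_comp_mk₀]
    congr 1
    refine ModuleCat.hom_ext (Submodule.linearMap_qext _ (LinearMap.ext_ring ?_))
    change f 1 • u = u
    rw [map_one, one_smul]

/-- Dimension shifting: embed `M` in an injective `E`. Since `E` stays injective over `R`,
`Ext^{i+1}` on either side is the cokernel of `Ext^i(E) → Ext^i(E/M)`, where induction applies. -/
lemma extBaseChange_bijective
    (hf : ∀ E : ModuleCat.{u} S, Injective E → Injective ((ModuleCat.restrictScalars f).obj E))
    (n i : ℕ) (M : ModuleCat.{u} S) : Function.Bijective (extBaseChange f J n i M) := by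
  induction i generalizing M with
  | zero => exact extBaseChange_zero_bijective n M
  | succ i ih =>
    let T : ShortComplex (ModuleCat.{u} S) :=
      ShortComplex.mk (Injective.ι M) (Limits.cokernel.π (Injective.ι M)) (by simp)
    have hT : T.ShortExact :=
      { exact := ShortComplex.exact_of_g_is_cokernel _ (Limits.cokernelIsCokernel _)
        mono_f := inferInstanceAs (Mono (Injective.ι M))
        epi_g := inferInstanceAs (Epi (Limits.cokernel.π (Injective.ι M))) }
    have hE : Injective T.X₂ := inferInstanceAs (Injective (Injective.under M))
    have hE' : Injective ((T.map (ModuleCat.restrictScalars f)).X₂) := hf _ hE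
    have hT' := hT.map_of_exact (ModuleCat.restrictScalars f)
    have hcls := Abelian.Ext.mapExactFunctor_extClass (ModuleCat.restrictScalars f) hT
    constructor
    · rw [injective_iff_map_eq_zero]
      intro x hx
      obtain ⟨w, rfl⟩ := Abelian.Ext.covariant_sequence_exact₁ _ hT x
        (Abelian.Ext.eq_zero_of_injective _) rfl
      rw [extBaseChange_comp, hcls] at hx
      obtain ⟨v, hv⟩ := Abelian.Ext.covariant_sequence_exact₃ _ hT' _ rfl hx
      obtain ⟨v, rfl⟩ := (ih T.X₂).2 v
      have hv' : (extBaseChange f J n i T.X₂ v).comp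
          ((Abelian.Ext.mk₀ T.g).mapExactFunctor (ModuleCat.restrictScalars f)) (add_zero i) =
          extBaseChange f J n i T.X₃ w := by
        rw [Abelian.Ext.mapExactFunctor_mk₀]
        exact hv
      rw [← extBaseChange_comp] at hv'
      have hw := (ih T.X₃).1 hv'
      rw [← hw, Abelian.Ext.comp_assoc _ _ _ _ (zero_add 1) (by omega), hT.comp_extClass,
        Abelian.Ext.comp_zero]
    · intro y
      obtain ⟨z, rfl⟩ := Abelian.Ext.covariant_sequence_exact₁ _ hT' y
        (Abelian.Ext.eq_zero_of_injective _) rfl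
      obtain ⟨w, rfl⟩ := (ih T.X₃).2 z
      exact ⟨w.comp hT.extClass rfl, by rw [extBaseChange_comp, hcls]; rfl⟩

/-- Multiplication by an `Ext` class vanishes on local cohomology over `S` if and only if it does
over `R`, for flat `R → S`. -/
lemma comp_eq_zero_iff_baseChange
    (hf : ∀ E : ModuleCat.{u} S, Injective E → Injective ((ModuleCat.restrictScalars f).obj E))
    {i j l : ℕ} {M N : ModuleCat.{u} S} (e : Abelian.Ext M N j) (h : i + j = l) :
    (∀ x : LocCoh (J.map f) i M, comp e h x = 0) ↔
      ∀ x : LocCoh J i ((ModuleCat.restrictScalars f).obj M),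
        comp (e.mapExactFunctor (ModuleCat.restrictScalars f)) h x = 0 := by
  constructor
  · intro H x
    obtain ⟨n, x, rfl⟩ := exists_of x
    obtain ⟨x, rfl⟩ := (extBaseChange_bijective hf n i M).2 x
    have h1 := H (of n x)
    rw [comp_of, of_eq_zero_iff] at h1
    obtain ⟨m, hm, h1⟩ := h1
    rw [comp_of, of_eq_zero_iff]
    exact ⟨m, hm, by rw [← extBaseChange_comp, ← extBaseChange_transition, h1, map_zero]⟩
  · intro H x
    obtain ⟨n, x, rfl⟩ := exists_of x
    have h1 := H (of n (extBaseChange f J n i M x))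
    rw [comp_of, of_eq_zero_iff] at h1
    obtain ⟨m, hm, h1⟩ := h1
    rw [comp_of, of_eq_zero_iff]
    refine ⟨m, hm, (extBaseChange_bijective hf m l N).1 ?_⟩
    rw [extBaseChange_transition, extBaseChange_comp, h1, map_zero]

end BaseChange

/-- Restriction of scalars along a flat homomorphism preserves injective modules. -/
lemma injective_restrictScalars_of_flat {R S : Type u} [CommRing R] [CommRing S] {f : R →+* S}
    (hf : f.Flat) (E : ModuleCat.{u} S) (hE : Injective E) :
    Injective ((ModuleCat.restrictScalars f).obj E) := by
  have := ModuleCat.preservesFiniteLimits_extendScalars_of_flat hf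
  exact (ModuleCat.extendRestrictScalarsAdj f).map_injective E hE

end LocCoh

end

/-! ### Flatness over the dual numbers. -/

noncomputable section

open CategoryTheory

namespace DualNumber

open scoped TensorProduct

/-- If `e` generates `N`, every element of `N ⊗ M` is of the form `e ⊗ m`. -/
lemma exists_eq_tmul {A N M : Type*} [CommRing A] [AddCommGroup N] [Module A N] [AddCommGroup M]
    [Module A M] (e : N) (he : ∀ a : N, ∃ c : A, a = c • e) (t : N ⊗[A] M) :
    ∃ m : M, t = e ⊗ₜ m := by
  induction t with
  | zero => exact ⟨0, (TensorProduct.tmul_zero _ _).symm⟩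
  | tmul a m =>
    obtain ⟨c, rfl⟩ := he a
    exact ⟨c • m, TensorProduct.smul_tmul ..⟩
  | add x y hx hy =>
    obtain ⟨m, rfl⟩ := hx
    obtain ⟨m', rfl⟩ := hy
    exact ⟨m + m', (TensorProduct.tmul_add _ _ _).symm⟩

/-- A module over the dual numbers is flat if and only if the kernel of `ε` is its image. -/
lemma flat_iff {k M : Type u} [Field k] [AddCommGroup M] [Module (DualNumber k) M] :
    Module.Flat (DualNumber k) M ↔
      ∀ m : M, (eps : DualNumber k) • m = 0 → ∃ m', m = (eps : DualNumber k) • m' := by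
  constructor
  · intro h m hm
    -- The equational criterion for the one-term relation `ε m = 0`: the coefficients it produces
    -- are killed by `ε`, hence are multiples of `ε`.
    have h1 : ∑ i : Fin 1, (fun _ => (eps : DualNumber k)) i • (fun _ => m) i = 0 := by
      simpa using hm
    obtain ⟨κ, a, y, h2, h3⟩ := Module.Flat.isTrivialRelation_of_sum_smul_eq_zero h1
    have h4 : ∀ j, a 0 j = eps * TrivSqZeroExt.inl (a 0 j).snd := by
      intro j
      have h5 := h3 j
      rw [Fin.sum_univ_one] at h5
      have h6 := congrArg TrivSqZeroExt.snd h5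
      ext
      · simpa using h6
      · simp
    refine ⟨∑ j, (TrivSqZeroExt.inl (a 0 j).snd : DualNumber k) • y j, ?_⟩
    rw [Finset.smul_sum]
    refine (h2 0).trans ?_
    refine Finset.sum_congr rfl fun j _ => ?_
    rw [smul_smul, ← h4]
  · intro h
    rw [Module.Flat.iff_lift_lsmul_comp_subtype_injective]
    intro I _
    -- The ideals of `k[ε]` are `0`, `(ε)` and the whole ring; only `(ε)` imposes a condition.
    rcases ideal_trichotomy I with rfl | rfl | rfl
    · exact Function.injective_of_subsingleton _
    · rw [injective_iff_map_eq_zero]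
      let e : Ideal.span {(eps : DualNumber k)} := ⟨eps, Ideal.mem_span_singleton_self _⟩
      have he : (eps : DualNumber k) • e = 0 := Subtype.ext eps_mul_eps
      intro t ht
      obtain ⟨m, rfl⟩ := exists_eq_tmul e (fun a => by
        obtain ⟨c, hc⟩ := Ideal.mem_span_singleton'.1 a.2
        exact ⟨c, Subtype.ext hc.symm⟩) t
      obtain ⟨m', rfl⟩ := h m ht
      rw [← TensorProduct.smul_tmul, he, TensorProduct.zero_tmul]
    · rw [injective_iff_map_eq_zero]
      let e : (⊤ : Ideal (DualNumber k)) := ⟨1, trivial⟩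
      intro t ht
      obtain ⟨m, rfl⟩ := exists_eq_tmul (A := DualNumber k) e
        (fun a => ⟨a.1, Subtype.ext (mul_one a.1).symm⟩) t
      have hm : m = 0 := (one_smul (DualNumber k) m).symm.trans ht
      rw [hm, TensorProduct.tmul_zero]

end DualNumber

/-! ### Arithmetic of polynomials over the dual numbers. -/

namespace FiberFull
variable {r : ℕ} {k : Type u} [Field k]

/-- The inclusion of `R` into `R[ε]`. -/
abbrev inclHom (r : ℕ) (k : Type u) [Field k] : PolyRing r k →+* PolyRing r (DualNumber k) :=
  MvPolynomial.map (TrivSqZeroExt.inlHom k k)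

-- `R[ε]` is the base change of the flat `k`-module `k[ε]` to `R`.
attribute [local instance] MvPolynomial.algebraMvPolynomial in
lemma flat_inclHom : (inclHom r k).Flat := by
  have : Module.Flat (PolyRing r k) (PolyRing r (DualNumber k)) :=
    Module.Flat.isBaseChange k (PolyRing r k) (DualNumber k) _ Algebra.IsPushout.out
  have h : inclHom r k = algebraMap (MvPolynomial (Fin (r + 1)) k)
    (MvPolynomial (Fin (r + 1)) (DualNumber k)) := rfl
  rwa [h, RingHom.flat_algebraMap_iff]

lemma map_inclHom_irrelevantIdeal :
    (irrelevantIdeal r k).map (inclHom r k) = irrelevantIdeal r (DualNumber k) := by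
  rw [irrelevantIdeal, Ideal.map_span, irrelevantIdeal]
  congr 1
  ext x
  simp

/-- The reduction `R[ε] → R`. -/
abbrev redHom (r : ℕ) (k : Type u) [Field k] : PolyRing r (DualNumber k) →+* PolyRing r k :=
  MvPolynomial.map (TrivSqZeroExt.fstHom k k k).toRingHom

lemma redHom_inclHom (f : PolyRing r k) : redHom r k (inclHom r k f) = f := by
  rw [redHom, inclHom, MvPolynomial.map_map]
  exact MvPolynomial.map_id f

lemma redHom_addEps (f g : PolyRing r k) : redHom r k (addEps f g) = f := by
  rw [addEps, map_add, map_mul, redHom_inclHom, redHom_inclHom, redHom, MvPolynomial.map_C]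
  simp

lemma coeff_addEps (f g : PolyRing r k) (m : Fin (r + 1) →₀ ℕ) :
    MvPolynomial.coeff m (addEps f g) =
      TrivSqZeroExt.inl (MvPolynomial.coeff m f) +
        TrivSqZeroExt.inr (MvPolynomial.coeff m g) := by
  rw [addEps, MvPolynomial.coeff_add, MvPolynomial.coeff_C_mul, MvPolynomial.coeff_map,
    MvPolynomial.coeff_map]
  ext <;> simp

lemma addEps_injective {f g f' g' : PolyRing r k} (h : addEps f g = addEps f' g') :
    f = f' ∧ g = g' := by
  constructor
  · rw [← redHom_addEps f g, h, redHom_addEps]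
  · ext m
    have h1 := congrArg (fun F => (MvPolynomial.coeff m F).snd) h
    simpa [coeff_addEps] using h1

lemma addEps_add (f g f' g' : PolyRing r k) :
    addEps f g + addEps f' g' = addEps (f + f') (g + g') := by
  simp only [addEps, map_add]
  ring

lemma addEps_sub (f g f' g' : PolyRing r k) :
    addEps f g - addEps f' g' = addEps (f - f') (g - g') := by
  simp only [addEps, map_sub]
  ring

lemma inclHom_eq_addEps (f : PolyRing r k) : inclHom r k f = addEps f 0 := by
  simp [addEps]

lemma eps_mul_addEps (f g : PolyRing r k) :
    MvPolynomial.C DualNumber.eps * addEps f g = addEps 0 f := by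
  have h : (MvPolynomial.C DualNumber.eps : PolyRing r (DualNumber k)) = addEps 0 1 := by
    simp [addEps]
  rw [h, addEps_mul]
  rw [zero_mul, zero_mul, one_mul, zero_add]

variable {I₀ : Ideal (PolyRing r k)}

lemma addEps_mem_deformationIdeal {φ : I₀ →ₗ[PolyRing r k] (PolyRing r k ⧸ I₀)}
    {f g : PolyRing r k} :
    addEps f g ∈ deformationIdeal φ ↔ ∃ hf : f ∈ I₀, φ ⟨f, hf⟩ = Ideal.Quotient.mk I₀ g := by
  constructor
  · rintro ⟨f', g', h, h'⟩
    obtain ⟨rfl, rfl⟩ := addEps_injective h'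
    exact ⟨f'.2, h⟩
  · rintro ⟨hf, h⟩
    exact ⟨⟨f, hf⟩, g, h, rfl⟩

lemma addEps_zero_mem_deformationIdeal {φ : I₀ →ₗ[PolyRing r k] (PolyRing r k ⧸ I₀)}
    {g : PolyRing r k} : addEps 0 g ∈ deformationIdeal φ ↔ g ∈ I₀ := by
  rw [addEps_mem_deformationIdeal]
  constructor
  · rintro ⟨hf, h⟩
    exact Ideal.Quotient.eq_zero_iff_mem.1 (h.symm.trans (map_zero φ))
  · intro h
    exact ⟨zero_mem _, (map_zero φ).trans (Ideal.Quotient.eq_zero_iff_mem.2 h).symm⟩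
end FiberFull
end

/-! ### First order deformations with flat quotient correspond to degree-preserving maps. -/

noncomputable section

open CategoryTheory

namespace FiberFull
variable {r : ℕ} {k : Type u} [Field k]

attribute [local instance] MvPolynomial.gradedAlgebra in
lemma isHomogeneousIdeal_iff {B : Type u} [CommRing B] {I : Ideal (PolyRing r B)} :
    IsHomogeneousIdeal I ↔ ∀ (i : ℕ), ∀ F ∈ I, MvPolynomial.homogeneousComponent i F ∈ I := by
  refine forall_congr' fun i => forall_congr' fun F => ?_
  rw [← MvPolynomial.decomposition.decompose'_apply]
  rfl

lemma homogeneousComponent_addEps (i : ℕ) (f g : PolyRing r k) :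
    MvPolynomial.homogeneousComponent i (addEps f g) =
      addEps (MvPolynomial.homogeneousComponent i f) (MvPolynomial.homogeneousComponent i g) := by
  ext m : 1
  rw [MvPolynomial.coeff_homogeneousComponent, coeff_addEps, coeff_addEps,
    MvPolynomial.coeff_homogeneousComponent, MvPolynomial.coeff_homogeneousComponent]
  split_ifs <;> simp

variable {I₀ : Ideal (PolyRing r k)}

/-- Take homogeneous representatives `G j` of the values of `φ` on the components of `f`. Then `g`
agrees with their sum modulo `I₀`, and components can be compared because `I₀` is homogeneous. In
degrees above that of `f`, the component of `f` is zero and `G i` lies in `I₀`. -/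
lemma apply_homogeneousComponent (hI₀ : IsHomogeneousIdeal I₀)
    {φ : I₀ →ₗ[PolyRing r k] (PolyRing r k ⧸ I₀)} (hφ : φ ∈ homDegreeZero I₀) (i : ℕ)
    {f g : PolyRing r k} (hf : f ∈ I₀) (h : φ ⟨f, hf⟩ = Ideal.Quotient.mk I₀ g) :
    φ ⟨MvPolynomial.homogeneousComponent i f, isHomogeneousIdeal_iff.1 hI₀ i f hf⟩ =
      Ideal.Quotient.mk I₀ (MvPolynomial.homogeneousComponent i g) := by
  have hI := isHomogeneousIdeal_iff.1 hI₀
  choose G hG hG' using fun j => hφ j ⟨MvPolynomial.homogeneousComponent j f, hI j f hf⟩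
    (MvPolynomial.homogeneousComponent_mem j f)
  have h1 : φ ⟨f, hf⟩ = Ideal.Quotient.mk I₀ (∑ j ∈ Finset.range (f.totalDegree + 1), G j) := by
    rw [map_sum, ← Finset.sum_congr rfl fun j _ => hG' j, ← map_sum]
    congr 1
    ext1
    rw [AddSubmonoidClass.coe_finsetSum]
    exact (MvPolynomial.sum_homogeneousComponent f).symm
  rw [h, Ideal.Quotient.eq] at h1
  have h2 := hI i _ h1
  rw [map_sub, map_sum] at h2
  have h3 : ∀ j, MvPolynomial.homogeneousComponent i (G j) = if i = j then G i else 0 := by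
    intro j
    rw [MvPolynomial.homogeneousComponent_of_mem (hG j)]
    split_ifs with h4
    · rw [h4]
    · rfl
  rw [Finset.sum_congr rfl fun j _ => h3 j, Finset.sum_ite_eq] at h2
  rw [hG' i, eq_comm, Ideal.Quotient.eq]
  split_ifs at h2 with h4
  · exact h2
  · have h5 : MvPolynomial.homogeneousComponent i f = 0 := by
      apply MvPolynomial.homogeneousComponent_eq_zero
      simp only [Finset.mem_range] at h4
      omega
    have h6 : G i ∈ I₀ := by
      rw [← Ideal.Quotient.eq_zero_iff_mem, ← hG' i]
      convert map_zero φ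
      exact h5
    rw [sub_zero] at h2
    exact sub_mem h2 h6

lemma isHomogeneousIdeal_deformationIdeal (hI₀ : IsHomogeneousIdeal I₀)
    {φ : I₀ →ₗ[PolyRing r k] (PolyRing r k ⧸ I₀)} (hφ : φ ∈ homDegreeZero I₀) :
    IsHomogeneousIdeal (deformationIdeal φ) := by
  rw [isHomogeneousIdeal_iff]
  rintro i _ ⟨f, g, h, rfl⟩
  rw [homogeneousComponent_addEps]
  exact addEps_mem_deformationIdeal.2 ⟨_, apply_homogeneousComponent hI₀ hφ i f.2 h⟩

lemma redHom_surjective : Function.Surjective (redHom r k) :=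
  fun f => ⟨_, redHom_inclHom f⟩

lemma exists_addEps_mem {I : Ideal (PolyRing r (DualNumber k))}
    (h : baseChange (TrivSqZeroExt.fstHom k k k).toRingHom I = I₀) {f : PolyRing r k}
    (hf : f ∈ I₀) : ∃ g, addEps f g ∈ I := by
  rw [← h] at hf
  obtain ⟨F, hF, rfl⟩ := (Ideal.mem_map_iff_of_surjective _ redHom_surjective).1 hf
  obtain ⟨f, g, rfl⟩ := exists_addEps F
  rw [redHom_addEps]
  exact ⟨g, hF⟩

lemma mem_of_addEps_mem {I : Ideal (PolyRing r (DualNumber k))}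
    (h : baseChange (TrivSqZeroExt.fstHom k k k).toRingHom I = I₀) {f g : PolyRing r k}
    (hf : addEps f g ∈ I) : f ∈ I₀ := by
  rw [← h, ← redHom_addEps f g]
  exact Ideal.mem_map_of_mem _ hf

lemma baseChange_deformationIdeal (φ : I₀ →ₗ[PolyRing r k] (PolyRing r k ⧸ I₀)) :
    baseChange (TrivSqZeroExt.fstHom k k k).toRingHom (deformationIdeal φ) = I₀ := by
  apply le_antisymm
  · refine Ideal.map_le_iff_le_comap.2 ?_
    rintro _ ⟨f, g, -, rfl⟩
    rw [Ideal.mem_comap]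
    exact (redHom_addEps f.1 g).symm ▸ f.2
  · intro f hf
    obtain ⟨g, hg⟩ := Ideal.Quotient.mk_surjective (φ ⟨f, hf⟩)
    rw [← redHom_addEps f g]
    exact Ideal.mem_map_of_mem _ (addEps_mem_deformationIdeal.2 ⟨hf, hg.symm⟩)

lemma eps_smul_mk {I : Ideal (PolyRing r (DualNumber k))} (f g : PolyRing r k) :
    (DualNumber.eps : DualNumber k) • Ideal.Quotient.mk I (addEps f g) =
      Ideal.Quotient.mk I (addEps 0 f) := by
  rw [← eps_mul_addEps f g, ← MvPolynomial.smul_eq_C_mul]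
  rfl

/-- If `ε` kills `f + εg`, then `f ∈ I₀`. With `g'` representing `φ(f)`, the element `f + εg'` lies
in `I_φ`, so `f + εg` is congruent to `ε(g - g')`. -/
lemma flat_quotient_deformationIdeal (φ : I₀ →ₗ[PolyRing r k] (PolyRing r k ⧸ I₀)) :
    Module.Flat (DualNumber k) (PolyRing r (DualNumber k) ⧸ deformationIdeal φ) := by
  rw [DualNumber.flat_iff]
  intro m hm
  obtain ⟨F, rfl⟩ := Ideal.Quotient.mk_surjective m
  obtain ⟨f, g, rfl⟩ := exists_addEps F
  rw [eps_smul_mk, Ideal.Quotient.eq_zero_iff_mem, addEps_zero_mem_deformationIdeal] at hm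
  obtain ⟨g', hg'⟩ := Ideal.Quotient.mk_surjective (φ ⟨f, hm⟩)
  refine ⟨Ideal.Quotient.mk _ (addEps (g - g') 0), ?_⟩
  rw [eps_smul_mk, Ideal.Quotient.eq, addEps_sub, sub_zero, sub_sub_cancel]
  exact addEps_mem_deformationIdeal.2 ⟨hm, hg'.symm⟩

lemma deformationIdeal_injective :
    Function.Injective (deformationIdeal (I₀ := I₀)) := by
  intro φ ψ h
  ext f
  obtain ⟨g, hg⟩ := Ideal.Quotient.mk_surjective (φ f)
  have h1 : addEps f.1 g ∈ deformationIdeal ψ :=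
    h ▸ addEps_mem_deformationIdeal.2 ⟨f.2, hg.symm⟩
  obtain ⟨_, h2⟩ := addEps_mem_deformationIdeal.1 h1
  exact hg.symm.trans h2.symm

/-- If `εg ∈ I`, then `ε` kills the class of `g`, so by flatness `g` is a multiple of `ε` modulo
`I`; reduce modulo `ε`. Conversely, multiply a lift of `g` in `I` by `ε`. -/
lemma addEps_zero_mem_iff {I : Ideal (PolyRing r (DualNumber k))}
    (h : baseChange (TrivSqZeroExt.fstHom k k k).toRingHom I = I₀)
    (hflat : Module.Flat (DualNumber k) (PolyRing r (DualNumber k) ⧸ I)) {g : PolyRing r k} :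
    addEps 0 g ∈ I ↔ g ∈ I₀ := by
  constructor
  · intro hg
    obtain ⟨m, hm⟩ := DualNumber.flat_iff.1 hflat (Ideal.Quotient.mk I (addEps g 0)) (by
      rwa [eps_smul_mk, Ideal.Quotient.eq_zero_iff_mem])
    obtain ⟨F, rfl⟩ := Ideal.Quotient.mk_surjective m
    obtain ⟨a, b, rfl⟩ := exists_addEps F
    rw [eps_smul_mk, Ideal.Quotient.eq, addEps_sub] at hm
    simpa using mem_of_addEps_mem h hm
  · intro hg
    obtain ⟨g', hg'⟩ := exists_addEps_mem h hg
    rw [← eps_mul_addEps g g']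
    exact I.mul_mem_left _ hg'

/-- Two lifts of `f` to `I` differ by some `ε(g - g')` in `I`, so their ε-parts agree modulo `I₀`.
This uniqueness makes the choice of lifts linear, and degree-preserving because `I` is homogeneous.
-/
lemma exists_deformationIdeal_eq {I : Ideal (PolyRing r (DualNumber k))}
    (hI : IsHomogeneousIdeal I)
    (h : baseChange (TrivSqZeroExt.fstHom k k k).toRingHom I = I₀)
    (hflat : Module.Flat (DualNumber k) (PolyRing r (DualNumber k) ⧸ I)) :
    ∃ φ ∈ homDegreeZero I₀, deformationIdeal φ = I := by
  choose G hG using fun f : I₀ => exists_addEps_mem h f.2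
  have huniq : ∀ (f : PolyRing r k) {g g' : PolyRing r k}, addEps f g ∈ I → addEps f g' ∈ I →
      Ideal.Quotient.mk I₀ g = Ideal.Quotient.mk I₀ g' := by
    intro f g g' hg hg'
    rw [Ideal.Quotient.eq, ← addEps_zero_mem_iff h hflat, ← sub_self f, ← addEps_sub]
    exact sub_mem hg hg'
  let φ : I₀ →ₗ[PolyRing r k] (PolyRing r k ⧸ I₀) :=
    { toFun := fun f => Ideal.Quotient.mk I₀ (G f)
      map_add' := fun f f' => by
        rw [← map_add]
        refine huniq (f.1 + f'.1) (hG (f + f')) ?_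
        rw [← addEps_add]
        exact add_mem (hG f) (hG f')
      map_smul' := fun a f => by
        change _ = Ideal.Quotient.mk I₀ a * Ideal.Quotient.mk I₀ (G f)
        rw [← map_mul]
        refine huniq (a * f.1) (hG (a • f)) ?_
        have h1 := I.mul_mem_left (addEps a 0) (hG f)
        rwa [addEps_mul, zero_mul, add_zero] at h1 }
  refine ⟨φ, ?_, ?_⟩
  · intro ν f hf
    refine ⟨MvPolynomial.homogeneousComponent ν (G f),
      MvPolynomial.homogeneousComponent_mem ν _, huniq f.1 (hG f) ?_⟩
    have h1 := isHomogeneousIdeal_iff.1 hI ν _ (hG f)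
    rwa [homogeneousComponent_addEps, MvPolynomial.homogeneousComponent_of_mem hf,
      if_pos rfl] at h1
  · ext F
    obtain ⟨f, g, rfl⟩ := exists_addEps F
    rw [addEps_mem_deformationIdeal]
    constructor
    · rintro ⟨hf, h1⟩
      have h2 : addEps 0 (g - G ⟨f, hf⟩) ∈ I := by
        rw [addEps_zero_mem_iff h hflat, ← Ideal.Quotient.eq]
        exact h1.symm
      have h3 := add_mem (hG ⟨f, hf⟩) h2
      rwa [addEps_add, add_zero, add_sub_cancel] at h3
    · intro h1
      exact ⟨mem_of_addEps_mem h h1, huniq f (hG ⟨f, _⟩) h1⟩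

end FiberFull
end

/-! ### Flatness of local cohomology in terms of connecting maps. -/

noncomputable section

open CategoryTheory

namespace LocCoh

variable {R : Type u} [CommRing R] {J : Ideal R} {i : ℕ} {M N : ModuleCat.{u} R}

lemma map_bijective_of_isIso (f : M ⟶ N) [IsIso f] :
    Function.Bijective (map f : LocCoh J i M →ₗ[R] LocCoh J i N) := by
  refine Function.bijective_iff_has_inverse.2 ⟨map (inv f), fun x => ?_, fun x => ?_⟩
  · rw [map_map, IsIso.hom_inv_id, map_id]
  · rw [map_map, IsIso.inv_hom_id, map_id]

/-- For an extension `0 → A → Q → A → 0` such that `a : Q → Q` is the composition `Q → A → Q`, the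
kernel of `a` on local cohomology is its image if and only if the connecting maps vanish. -/
lemma smul_exact_iff {A Q : ModuleCat.{u} R} {ι : A ⟶ Q} {p : Q ⟶ A} {w : ι ≫ p = 0}
    (hS : (ShortComplex.mk ι p w).ShortExact) {a : R} (ha : p ≫ ι = a • 𝟙 Q) :
    (∀ (i : ℕ) (x : LocCoh J i Q), a • x = 0 → ∃ y, x = a • y) ↔
      ∀ (i : ℕ) (x : LocCoh J i A), (comp hS.extClass rfl x : LocCoh J (i + 1) A) = 0 := by
  have hsmul : ∀ {i : ℕ} (x : LocCoh J i Q), a • x = map ι (map p x) := fun x => by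
    rw [map_map, ha, map_smul_id]
  have hmono : Mono ι := hS.mono_f
  have hinj : ∀ {i : ℕ}, (∀ x : LocCoh J i A, (comp hS.extClass rfl x : LocCoh J (i + 1) A) = 0) →
      ∀ z : LocCoh J (i + 1) A, map ι z = 0 → z = 0 := fun h z hz => by
    obtain ⟨y, rfl⟩ := exists_of_map_f_eq_zero hS rfl z hz
    exact h y
  have hinj0 : ∀ z : LocCoh J 0 A, map ι z = 0 → z = 0 := fun z hz =>
    map_injective_of_mono ι (hz.trans (map_zero _).symm)
  constructor
  · intro H i
    -- The class `ι z` is killed by `a`, since `a` acts as `ι ∘ p` and `p ∘ ι = 0`; hence `ι z = ι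
    -- (p y)`. Injectivity of `ι` in degree `i` gives `z = p y`, so `δ z = 0`, and then `ι` is
    -- injective in degree `i + 1`.
    have step : ∀ i, (∀ z : LocCoh J i A, map ι z = 0 → z = 0) → ∀ x : LocCoh J i A,
        (comp hS.extClass rfl x : LocCoh J (i + 1) A) = 0 := by
      intro i h z
      obtain ⟨y, hy⟩ := H i (map ι z) (by
        rw [hsmul, map_map ι p, w, zero_map, map_zero])
      rw [hsmul, ← sub_eq_zero, ← map_sub] at hy
      rw [sub_eq_zero.1 (h _ hy)]
      exact δ_map_g hS rfl y
    induction i with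
    | zero => exact step 0 hinj0
    | succ i ih => exact step (i + 1) (hinj ih)
  · intro H i x hx
    have h : ∀ z : LocCoh J i A, map ι z = 0 → z = 0 := by
      cases i with
      | zero => exact hinj0
      | succ i => exact hinj (H i)
    rw [hsmul] at hx
    obtain ⟨z, rfl⟩ := exists_of_map_g_eq_zero hS x (h _ hx)
    obtain ⟨y, rfl⟩ := exists_of_δ_eq_zero hS rfl z (H i z)
    exact ⟨y, (hsmul y).symm⟩

/-- The connecting maps of a short exact sequence over `S` vanish on local cohomology if and only
if they do over `R`, for flat `R → S`. -/
lemma connecting_eq_zero_iff_baseChange {S : Type u} [CommRing S] {f : R →+* S}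
    (hf : ∀ E : ModuleCat.{u} S, Injective E → Injective ((ModuleCat.restrictScalars f).obj E))
    {T : ShortComplex (ModuleCat.{u} S)} (hT : T.ShortExact) {l : ℕ} (h : i + 1 = l) :
    (∀ x : LocCoh (J.map f) i T.X₃, comp hT.extClass h x = 0) ↔
      ∀ x : LocCoh J i (T.map (ModuleCat.restrictScalars f)).X₃,
        comp (hT.map_of_exact (ModuleCat.restrictScalars f)).extClass h x = 0 := by
  rw [comp_eq_zero_iff_baseChange hf, Abelian.Ext.mapExactFunctor_extClass]
  rfl

end LocCoh

/-! ### The extension defined by `φ` and its connecting maps. -/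

namespace FiberFull
variable {r : ℕ} {k : Type u} [Field k] {I₀ : Ideal (PolyRing r k)}

/-- The multiplication by `ε`, as a semilinear map `R / I₀ → R[ε] / I_φ`. -/
def epsMul (φ : I₀ →ₗ[PolyRing r k] (PolyRing r k ⧸ I₀)) :
    (PolyRing r k ⧸ I₀) →ₛₗ[inclHom r k] (PolyRing r (DualNumber k) ⧸ deformationIdeal φ) :=
  Submodule.liftQ I₀
    { toFun := fun g => Ideal.Quotient.mk _ (addEps 0 g)
      map_add' := fun g g' => by rw [← map_add, addEps_add, add_zero]
      map_smul' := fun a g => by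
        change _ = Ideal.Quotient.mk _ (inclHom r k a * addEps 0 g)
        rw [inclHom_eq_addEps, addEps_mul, mul_zero, zero_mul, add_zero, smul_eq_mul] }
    fun _ hg => Ideal.Quotient.eq_zero_iff_mem.2 (addEps_zero_mem_deformationIdeal.2 hg)

lemma epsMul_mk (φ : I₀ →ₗ[PolyRing r k] (PolyRing r k ⧸ I₀)) (g : PolyRing r k) :
    epsMul φ (Ideal.Quotient.mk I₀ g) = Ideal.Quotient.mk _ (addEps 0 g) := rfl

variable (I₀) in
/-- `R / I₀` as an `R[ε]`-module. -/
def ClosedFiber : Type u := PolyRing r k ⧸ I₀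

instance : AddCommGroup (ClosedFiber I₀) :=
  inferInstanceAs (AddCommGroup (PolyRing r k ⧸ I₀))

instance : Module (PolyRing r (DualNumber k)) (ClosedFiber I₀) :=
  Module.compHom (PolyRing r k ⧸ I₀) (redHom r k)

/-- The injection `R / I₀ → R[ε] / I_φ`, as a map of `R[ε]`-modules. -/
def closedFiberι (φ : I₀ →ₗ[PolyRing r k] (PolyRing r k ⧸ I₀)) :
    ClosedFiber I₀ →ₗ[PolyRing r (DualNumber k)]
      (PolyRing r (DualNumber k) ⧸ deformationIdeal φ) where
  toFun := epsMul φ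
  map_add' := map_add (epsMul φ)
  map_smul' F x := by
    obtain ⟨f, g, rfl⟩ := exists_addEps F
    obtain ⟨x, rfl⟩ := Ideal.Quotient.mk_surjective (I := I₀) x
    change epsMul φ (Ideal.Quotient.mk I₀ (redHom r k (addEps f g) * x)) =
      Ideal.Quotient.mk _ (addEps f g * addEps 0 x)
    rw [redHom_addEps, epsMul_mk, addEps_mul, mul_zero, mul_zero, add_zero]

/-- The projection `R[ε] / I_φ → R / I₀`, as a map of `R[ε]`-modules. -/
def closedFiberπ (φ : I₀ →ₗ[PolyRing r k] (PolyRing r k ⧸ I₀)) :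
    (PolyRing r (DualNumber k) ⧸ deformationIdeal φ) →ₗ[PolyRing r (DualNumber k)]
      ClosedFiber I₀ where
  toFun := Ideal.quotientMap I₀ (redHom r k)
    (Ideal.map_le_iff_le_comap.1 (baseChange_deformationIdeal φ).le)
  map_add' := map_add _
  map_smul' F x := by
    obtain ⟨x, rfl⟩ := Ideal.Quotient.mk_surjective x
    change Ideal.quotientMap _ _ _ (Ideal.Quotient.mk _ (F * x)) =
      Ideal.Quotient.mk I₀ (redHom r k F * redHom r k x)
    rw [Ideal.quotientMap_mk, map_mul]

lemma closedFiberπ_mk (φ : I₀ →ₗ[PolyRing r k] (PolyRing r k ⧸ I₀)) (f g : PolyRing r k) :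
    closedFiberπ φ (Ideal.Quotient.mk _ (addEps f g)) = Ideal.Quotient.mk I₀ f :=
  congrArg (Ideal.Quotient.mk I₀) (redHom_addEps f g)

lemma closedFiberι_mk (φ : I₀ →ₗ[PolyRing r k] (PolyRing r k ⧸ I₀)) (g : PolyRing r k) :
    closedFiberι φ (Ideal.Quotient.mk I₀ g) = Ideal.Quotient.mk _ (addEps 0 g) := rfl

lemma closedFiberι_injective (φ : I₀ →ₗ[PolyRing r k] (PolyRing r k ⧸ I₀)) :
    Function.Injective (closedFiberι φ) := by
  rw [injective_iff_map_eq_zero]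
  intro x hx
  obtain ⟨x, rfl⟩ := Ideal.Quotient.mk_surjective (I := I₀) x
  rw [closedFiberι_mk, Ideal.Quotient.eq_zero_iff_mem, addEps_zero_mem_deformationIdeal] at hx
  exact Ideal.Quotient.eq_zero_iff_mem.2 hx

lemma closedFiberπ_surjective (φ : I₀ →ₗ[PolyRing r k] (PolyRing r k ⧸ I₀)) :
    Function.Surjective (closedFiberπ φ) := by
  intro x
  obtain ⟨x, rfl⟩ := Ideal.Quotient.mk_surjective (I := I₀) x
  exact ⟨_, closedFiberπ_mk φ x 0⟩

lemma exact_closedFiber (φ : I₀ →ₗ[PolyRing r k] (PolyRing r k ⧸ I₀)) :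
    Function.Exact (closedFiberι φ) (closedFiberπ φ) := by
  intro x
  constructor
  · intro hx
    obtain ⟨F, rfl⟩ := Ideal.Quotient.mk_surjective x
    obtain ⟨f, g, rfl⟩ := exists_addEps F
    have hf : f ∈ I₀ := Ideal.Quotient.eq_zero_iff_mem.1 ((closedFiberπ_mk φ f g).symm.trans hx)
    obtain ⟨g', hg'⟩ := Ideal.Quotient.mk_surjective (φ ⟨f, hf⟩)
    refine ⟨Ideal.Quotient.mk I₀ (g - g'), ?_⟩
    rw [closedFiberι_mk, eq_comm, Ideal.Quotient.eq, addEps_sub, sub_zero, sub_sub_cancel]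
    exact addEps_mem_deformationIdeal.2 ⟨hf, hg'.symm⟩
  · rintro ⟨x, rfl⟩
    obtain ⟨x, rfl⟩ := Ideal.Quotient.mk_surjective (I := I₀) x
    rw [closedFiberι_mk, closedFiberπ_mk, map_zero]
    rfl

/-- The extension `0 → R / I₀ → R[ε] / I_φ → R / I₀ → 0`. -/
abbrev closedFiberComplex (φ : I₀ →ₗ[PolyRing r k] (PolyRing r k ⧸ I₀)) :
    ShortComplex (ModuleCat.{u} (PolyRing r (DualNumber k))) :=
  ShortComplex.mk (ModuleCat.ofHom (closedFiberι φ)) (ModuleCat.ofHom (closedFiberπ φ))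
    (ModuleCat.ofHom_comp_eq_zero (exact_closedFiber φ))

lemma shortExact_closedFiberComplex (φ : I₀ →ₗ[PolyRing r k] (PolyRing r k ⧸ I₀)) :
    (closedFiberComplex φ).ShortExact :=
  ModuleCat.shortExact_of_linearMap _ _ (closedFiberι_injective φ) (exact_closedFiber φ)
    (closedFiberπ_surjective φ) _

lemma closedFiberComplex_comp (φ : I₀ →ₗ[PolyRing r k] (PolyRing r k ⧸ I₀)) :
    (closedFiberComplex φ).g ≫ (closedFiberComplex φ).f =
      (MvPolynomial.C DualNumber.eps : PolyRing r (DualNumber k)) • 𝟙 _ := by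
  refine ModuleCat.hom_ext (LinearMap.ext fun x => ?_)
  obtain ⟨F, rfl⟩ := Ideal.Quotient.mk_surjective x
  obtain ⟨f, g, rfl⟩ := exists_addEps F
  change closedFiberι φ (closedFiberπ φ (Ideal.Quotient.mk _ (addEps f g))) =
    Ideal.Quotient.mk _ (MvPolynomial.C DualNumber.eps * addEps f g)
  rw [closedFiberπ_mk, closedFiberι_mk, eps_mul_addEps]

/-- The criterion for dual numbers, transported to `LocCoh`; `ε` acts through the constant
polynomial. -/
lemma flat_locCoh_iff (I : Ideal (PolyRing r (DualNumber k))) (i : ℕ) :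
    Module.Flat (DualNumber k)
        ((ModuleCat.restrictScalars (algebraMap (DualNumber k) (PolyRing r (DualNumber k)))).obj
          ((localCoh r (DualNumber k) i).obj
            (ModuleCat.of (PolyRing r (DualNumber k)) (PolyRing r (DualNumber k) ⧸ I)))) ↔
      ∀ x : LocCoh (irrelevantIdeal r (DualNumber k)) i
          (ModuleCat.of (PolyRing r (DualNumber k)) (PolyRing r (DualNumber k) ⧸ I)),
        (MvPolynomial.C DualNumber.eps : PolyRing r (DualNumber k)) • x = 0 →
          ∃ y, x = (MvPolynomial.C DualNumber.eps : PolyRing r (DualNumber k)) • y := by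
  let E := LocCoh.equivFunctor (irrelevantIdeal r (DualNumber k)) i
    (ModuleCat.of (PolyRing r (DualNumber k)) (PolyRing r (DualNumber k) ⧸ I))
  rw [DualNumber.flat_iff]
  constructor
  · intro h x hx
    obtain ⟨m, hm⟩ := h (E x) (by
      change (MvPolynomial.C DualNumber.eps : PolyRing r (DualNumber k)) • E x = 0
      rw [← map_smul, hx, map_zero])
    obtain ⟨y, hy⟩ := E.surjective m
    subst hy
    exact ⟨y, E.injective (hm.trans (map_smul E _ y).symm)⟩
  · intro h m hm
    obtain ⟨x, hx⟩ := E.surjective m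
    subst hx
    obtain ⟨y, rfl⟩ := h x (E.injective (((map_smul E _ _).trans hm).trans (map_zero E).symm))
    exact ⟨E y, map_smul E _ _⟩

variable (I₀) in
/-- The short complex `I₀ → R → R / I₀`. -/
abbrev idealComplex : ShortComplex (ModuleCat.{u} (PolyRing r k)) :=
  ShortComplex.mk (ModuleCat.ofHom I₀.subtype) (ModuleCat.ofHom I₀.mkQ)
    (ModuleCat.ofHom_comp_eq_zero (LinearMap.exact_subtype_mkQ I₀))

variable (I₀) in
lemma shortExact_idealComplex : (idealComplex I₀).ShortExact :=
  ModuleCat.shortExact_of_linearMap _ _ I₀.subtype_injective (LinearMap.exact_subtype_mkQ I₀)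
    I₀.mkQ_surjective _

variable (I₀) in
/-- `R / I₀` is its own restriction along `R → R[ε] → R`. -/
def closedFiberHom : ModuleCat.of (PolyRing r k) (PolyRing r k ⧸ I₀) ⟶
    (ModuleCat.restrictScalars (inclHom r k)).obj
      (ModuleCat.of (PolyRing r (DualNumber k)) (ClosedFiber I₀)) :=
  ModuleCat.ofHom (Y := (ModuleCat.restrictScalars (inclHom r k)).obj
      (ModuleCat.of (PolyRing r (DualNumber k)) (ClosedFiber I₀)))
    { toFun := fun x => (show ClosedFiber I₀ from x)
      map_add' := fun _ _ => rfl
      map_smul' := fun a x => by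
        change a • x = redHom r k (inclHom r k a) • x
        rw [redHom_inclHom] }

instance : IsIso (closedFiberHom I₀) :=
  (ConcreteCategory.isIso_iff_bijective _).2 Function.bijective_id

/-- The map `R → R[ε] / I_φ`. -/
def inclQuotient (φ : I₀ →ₗ[PolyRing r k] (PolyRing r k ⧸ I₀)) :
    ModuleCat.of (PolyRing r k) (PolyRing r k) ⟶
      (ModuleCat.restrictScalars (inclHom r k)).obj (ModuleCat.of (PolyRing r (DualNumber k))
        (PolyRing r (DualNumber k) ⧸ deformationIdeal φ)) :=
  ModuleCat.ofHom (Y := (ModuleCat.restrictScalars (inclHom r k)).obj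
      (ModuleCat.of (PolyRing r (DualNumber k))
        (PolyRing r (DualNumber k) ⧸ deformationIdeal φ)))
    { toFun := fun a => Ideal.Quotient.mk (deformationIdeal φ) (inclHom r k a)
      map_add' := fun a b => by rw [map_add, map_add]; rfl
      map_smul' := fun a b => by
        change _ = Ideal.Quotient.mk _ (inclHom r k a) * Ideal.Quotient.mk _ (inclHom r k b)
        rw [smul_eq_mul, map_mul, map_mul] }

/-- The map from `I₀ → R → R / I₀` to the extension `R / I₀ → R[ε] / I_φ → R / I₀` over `R`. -/
def idealComplexMap (φ : I₀ →ₗ[PolyRing r k] (PolyRing r k ⧸ I₀)) :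
    idealComplex I₀ ⟶ (closedFiberComplex φ).map (ModuleCat.restrictScalars (inclHom r k)) where
  -- Since `f + εg ∈ I_φ` when `g` represents `φ(f)`, one has `ε φ(f) = -f` in `R[ε]/I_φ`; this
  -- forces the signs on `τ₂` and `τ₃`.
  τ₁ := ModuleCat.ofHom φ ≫ closedFiberHom I₀
  τ₂ := -inclQuotient φ
  τ₃ := -closedFiberHom I₀
  comm₁₂ := by
    refine ModuleCat.hom_ext (LinearMap.ext fun f => ?_)
    obtain ⟨g, hg⟩ := Ideal.Quotient.mk_surjective (φ f)
    change closedFiberι φ (φ f) = -Ideal.Quotient.mk _ (inclHom r k f)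
    rw [← hg, closedFiberι_mk, inclHom_eq_addEps, eq_neg_iff_add_eq_zero, ← map_add,
      addEps_add, zero_add, add_zero, Ideal.Quotient.eq_zero_iff_mem]
    exact addEps_mem_deformationIdeal.2 ⟨f.2, hg.symm⟩
  comm₂₃ := by
    refine ModuleCat.hom_ext (LinearMap.ext fun f => ?_)
    change closedFiberπ φ (-Ideal.Quotient.mk _ (inclHom r k f)) = -Ideal.Quotient.mk I₀ f
    rw [map_neg, inclHom_eq_addEps, closedFiberπ_mk]
    rfl

instance (φ : I₀ →ₗ[PolyRing r k] (PolyRing r k ⧸ I₀)) : IsIso (idealComplexMap φ).τ₃ :=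
  (ConcreteCategory.isIso_iff_bijective _).2 (Equiv.neg (ClosedFiber I₀)).bijective

/-- After restriction to `R`, naturality of the extension class along `idealComplexMap` identifies
`φ ∘ δ` with the connecting map up to isomorphisms at both ends: the left one is `closedFiberHom`,
the right one its negative. -/
lemma connecting_closedFiber_eq_zero_iff (φ : I₀ →ₗ[PolyRing r k] (PolyRing r k ⧸ I₀)) (i : ℕ) :
    (∀ x : LocCoh (irrelevantIdeal r (DualNumber k)) i
        (ModuleCat.of (PolyRing r (DualNumber k)) (ClosedFiber I₀)),
      (LocCoh.comp (shortExact_closedFiberComplex φ).extClass rfl x :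
        LocCoh _ (i + 1) (ModuleCat.of (PolyRing r (DualNumber k)) (ClosedFiber I₀))) = 0) ↔
    ∀ x : LocCoh (irrelevantIdeal r k) i (ModuleCat.of (PolyRing r k) (PolyRing r k ⧸ I₀)),
      LocCoh.map (ModuleCat.ofHom φ) (LocCoh.comp (shortExact_idealComplex I₀).extClass rfl x :
        LocCoh _ (i + 1) (ModuleCat.of (PolyRing r k) I₀)) = 0 := by
  rw [← map_inclHom_irrelevantIdeal]
  refine (LocCoh.connecting_eq_zero_iff_baseChange
    (LocCoh.injective_restrictScalars_of_flat flat_inclHom)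
    (shortExact_closedFiberComplex φ) rfl).trans ?_
  have hnat := (shortExact_idealComplex I₀).extClass_naturality
    ((shortExact_closedFiberComplex φ).map_of_exact (ModuleCat.restrictScalars (inclHom r k)))
    (idealComplexMap φ)
  have key : ∀ x : LocCoh (irrelevantIdeal r k) i
      (ModuleCat.of (PolyRing r k) (PolyRing r k ⧸ I₀)),
      LocCoh.map (closedFiberHom I₀)
        (LocCoh.map (ModuleCat.ofHom φ) (LocCoh.comp (shortExact_idealComplex I₀).extClass rfl x :
          LocCoh _ (i + 1) (ModuleCat.of (PolyRing r k) I₀))) =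
      LocCoh.comp ((shortExact_closedFiberComplex φ).map_of_exact
        (ModuleCat.restrictScalars (inclHom r k))).extClass rfl
        (LocCoh.map (idealComplexMap φ).τ₃ x) := by
    intro x
    have h1 := LocCoh.comp_comp (shortExact_idealComplex I₀).extClass (i := i) rfl
      (Abelian.Ext.mk₀ (idealComplexMap φ).τ₁) (add_zero _) (add_zero 1) x
    rw [hnat] at h1
    refine (LocCoh.map_map _ _ _).trans (h1.trans ?_)
    exact (LocCoh.comp_comp (Abelian.Ext.mk₀ (idealComplexMap φ).τ₃) _ _ _ (zero_add 1) x).symm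
  constructor
  · intro H x
    apply (LocCoh.map_bijective_of_isIso (closedFiberHom I₀)).1
    rw [key, map_zero]
    exact H _
  · intro H x
    obtain ⟨x, rfl⟩ := (LocCoh.map_bijective_of_isIso (idealComplexMap φ).τ₃).2 x
    exact (key x).symm.trans ((congrArg (LocCoh.map _) (H x)).trans (map_zero _))

/-- The classes not hit by `δ` are harmless. Up to degree `r`, vanishing of `H^i(R)` makes `δ`
surjective onto `H^i(I₀)`, and `H^0(I₀)` embeds in `H^0(R) = 0`. Beyond degree `r` either the target
or, when `I₀ = 0`, the source is zero. -/
lemma map_eq_zero_iff_connecting (φ : I₀ →ₗ[PolyRing r k] (PolyRing r k ⧸ I₀)) :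
    (∀ (i : ℕ) (x : LocCoh (irrelevantIdeal r k) i (ModuleCat.of (PolyRing r k) I₀)),
      LocCoh.map (ModuleCat.ofHom φ) x = 0) ↔
    ∀ (i : ℕ) (x : LocCoh (irrelevantIdeal r k) i
        (ModuleCat.of (PolyRing r k) (PolyRing r k ⧸ I₀))),
      LocCoh.map (ModuleCat.ofHom φ) (LocCoh.comp (shortExact_idealComplex I₀).extClass rfl x :
        LocCoh _ (i + 1) (ModuleCat.of (PolyRing r k) I₀)) = 0 := by
  refine ⟨fun H i x => H _ _, fun H i x => ?_⟩
  by_cases hi : i < r + 1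
  · have h0 : LocCoh.map (idealComplex I₀).f x = 0 := (subsingleton_locCoh_polyRing i hi).elim _ _
    cases i with
    | zero =>
      have : Mono (idealComplex I₀).f := (shortExact_idealComplex I₀).mono_f
      rw [LocCoh.map_injective_of_mono (idealComplex I₀).f (h0.trans (map_zero _).symm), map_zero]
    | succ i =>
      obtain ⟨y, rfl⟩ := LocCoh.exists_of_map_f_eq_zero (shortExact_idealComplex I₀) rfl x h0
      exact H i y
  · by_cases hI : I₀ = ⊥
    · subst hI
      rw [(LocCoh.subsingleton_of_subsingleton _ _).elim x 0, map_zero]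
    · exact (subsingleton_locCoh_quotient hI i (by omega)).elim _ _

lemma flat_locCoh_deformationIdeal_iff (φ : I₀ →ₗ[PolyRing r k] (PolyRing r k ⧸ I₀)) :
    (∀ i : ℕ, Module.Flat (DualNumber k)
        ((ModuleCat.restrictScalars (algebraMap (DualNumber k) (PolyRing r (DualNumber k)))).obj
          ((localCoh r (DualNumber k) i).obj (ModuleCat.of (PolyRing r (DualNumber k))
            (PolyRing r (DualNumber k) ⧸ deformationIdeal φ))))) ↔
      ∀ i : ℕ, localCohMap i φ = 0 := by
  refine (forall_congr' fun i => flat_locCoh_iff (deformationIdeal φ) i).trans ?_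
  refine (LocCoh.smul_exact_iff (shortExact_closedFiberComplex φ)
    (closedFiberComplex_comp φ)).trans ?_
  refine (forall_congr' fun i => connecting_closedFiber_eq_zero_iff φ i).trans ?_
  refine (map_eq_zero_iff_connecting φ).symm.trans ?_
  exact forall_congr' fun i => (LocCoh.localCohomology_map_eq_zero_iff _).symm

lemma bijOn_deformationIdeal (hI₀ : IsHomogeneousIdeal I₀) :
    Set.BijOn (fun φ : homDegreeZero I₀ => deformationIdeal φ.1)
      {φ | ∀ i : ℕ, localCohMap i φ.1 = 0}
      (localFib I₀ (TrivSqZeroExt.fstHom k k k).toRingHom) := by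
  refine ⟨fun φ hφ => ⟨⟨isHomogeneousIdeal_deformationIdeal hI₀ φ.2,
    flat_quotient_deformationIdeal φ.1, (flat_locCoh_deformationIdeal_iff φ.1).2 hφ⟩,
    baseChange_deformationIdeal φ.1⟩,
    (deformationIdeal_injective.comp Subtype.val_injective).injOn, ?_⟩
  rintro I ⟨⟨hI, hflat, hcoh⟩, hI'⟩
  obtain ⟨φ, hφ, rfl⟩ := exists_deformationIdeal_eq hI hI' hflat
  exact ⟨⟨φ, hφ⟩, (flat_locCoh_deformationIdeal_iff φ).1 hcoh, rfl⟩

end FiberFull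
end

/-! ### The subspace of maps that vanish on local cohomology. -/

noncomputable section

open CategoryTheory AlgebraicGeometry

namespace FiberFull

section Tangent

variable {r : ℕ} {k : Type u} [Field k] (I₀ : Ideal (PolyRing r k))

/-- The degree-preserving maps `I₀ → R / I₀` that vanish on local cohomology. -/
def locCohTangent : Submodule k (homDegreeZero I₀) where
  carrier := {φ | ∀ i : ℕ, localCohMap i φ.1 = 0}
  add_mem' {φ ψ} hφ hψ i := by
    refine (LocCoh.localCohomology_map_eq_zero_iff _).2 fun x => ?_
    have h1 := (LocCoh.localCohomology_map_eq_zero_iff _).1 (hφ i) x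
    have h2 := (LocCoh.localCohomology_map_eq_zero_iff _).1 (hψ i) x
    have h3 := LocCoh.add_map (ModuleCat.ofHom φ.1) (ModuleCat.ofHom ψ.1) x
    rw [h1, h2, add_zero] at h3
    exact h3
  zero_mem' i := (LocCoh.localCohomology_map_eq_zero_iff _).2 fun x => LocCoh.zero_map x
  smul_mem' c φ hφ i := by
    refine (LocCoh.localCohomology_map_eq_zero_iff _).2 fun x => ?_
    have h1 := (LocCoh.localCohomology_map_eq_zero_iff _).1 (hφ i) x
    -- Scaling `φ` by `c` is composition with the endomorphism `C c` of `R / I₀`, so functoriality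
    -- suffices.
    have h2 := LocCoh.map_map (ModuleCat.ofHom φ.1)
      ((MvPolynomial.C c : PolyRing r k) • 𝟙 (ModuleCat.of (PolyRing r k) (PolyRing r k ⧸ I₀))) x
    rw [h1, map_zero] at h2
    refine Eq.trans ?_ h2.symm
    congr 2
    refine ModuleCat.hom_ext (LinearMap.ext fun y => ?_)
    obtain ⟨g, hg⟩ := Ideal.Quotient.mk_surjective (φ.1 y)
    change c • φ.1 y = (MvPolynomial.C c : PolyRing r k) • φ.1 y
    rw [← hg]
    change Ideal.Quotient.mk I₀ (c • g) = Ideal.Quotient.mk I₀ (MvPolynomial.C c * g)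
    rw [MvPolynomial.smul_eq_C_mul]

variable {I₀} in
lemma mem_fib (hI₀ : IsHomogeneousIdeal I₀) : I₀ ∈ fib r k :=
  ⟨hI₀, inferInstance, fun _ => inferInstance⟩

end Tangent

/-! ### Tangent vectors as points with values in the dual numbers. -/

section Points

variable {k : Type u} [Field k] {X : Scheme.{u}} {s : X ⟶ Spec (CommRingCat.of k)}
  (x : Points s k)

lemma eval_eq_zero_of_mem {a : Stalk x} (ha : a ∈ IsLocalRing.maximalIdeal (Stalk x)) :
    eval x a = 0 := by
  by_contra h
  have h1 := sub_mem ha (sub_eval_mem x a)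
  rw [sub_sub_cancel] at h1
  exact (IsLocalRing.mem_maximalIdeal _).1 h1 ((IsUnit.mk0 _ h).map (algebraMap k (Stalk x)))

lemma differential_of_mem {a : Stalk x} (ha : a ∈ IsLocalRing.maximalIdeal (Stalk x)) :
    differential x a = (IsLocalRing.maximalIdeal (Stalk x)).toCotangent ⟨a, ha⟩ := by
  change (IsLocalRing.maximalIdeal (Stalk x)).toCotangent _ = _
  congr 1
  ext
  change a - algebraMap k (Stalk x) (eval x a) = a
  rw [eval_eq_zero_of_mem x ha, map_zero, sub_zero]

lemma differential_surjective : Function.Surjective (differential x) := by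
  intro c
  obtain ⟨⟨a, ha⟩, rfl⟩ := (IsLocalRing.maximalIdeal (Stalk x)).toCotangent_surjective c
  exact ⟨a, differential_of_mem x ha⟩

lemma tangentHom_apply (v : TangentSpace x) (a : Stalk x) :
    tangentHom x v a =
      TrivSqZeroExt.inl (eval x a) + TrivSqZeroExt.inr (v (differential x a)) := rfl

lemma fst_tangentHom (v : TangentSpace x) (a : Stalk x) : (tangentHom x v a).fst = eval x a := by
  simp [tangentHom_apply]

lemma tangentPoint_map_fst (v : TangentSpace x) :
    (tangentPoint x v).map (TrivSqZeroExt.fstHom k k k) = x := by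
  ext1
  have h : tangentStalkHom x v ≫ CommRingCat.ofHom (TrivSqZeroExt.fstHom k k k).toRingHom =
      evalHom x :=
    CommRingCat.hom_ext (RingHom.ext fun a => fst_tangentHom x v a)
  change Spec.map _ ≫ Spec.map (tangentStalkHom x v) ≫ X.fromSpecStalk x.point = x.hom
  rw [← Spec.map_comp_assoc, h, evalHom_fromSpecStalk]

lemma tangentPoint_injective : Function.Injective (tangentPoint x) := by
  intro v w h
  have h1 : Spec.map (tangentStalkHom x v) ≫ X.fromSpecStalk x.point =
      Spec.map (tangentStalkHom x w) ≫ X.fromSpecStalk x.point := congrArg Points.hom h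
  have h2 := Spec.map_injective ((cancel_mono _).1 h1)
  refine LinearMap.ext fun c => ?_
  obtain ⟨a, rfl⟩ := differential_surjective x c
  have h3 : tangentHom x v a = tangentHom x w a := congrArg (fun g => g.hom a) h2
  simpa [tangentHom_apply] using congrArg TrivSqZeroExt.snd h3

/-- A homomorphism from the local ring to the dual numbers is given by a tangent vector. -/
lemma exists_tangentHom_eq (g : Stalk x →ₐ[k] DualNumber k)
    (hg : ∀ a, (g a).fst = eval x a) : ∃ v : TangentSpace x, tangentHom x v = g := by
  let m := IsLocalRing.maximalIdeal (Stalk x)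
  let q : m →ₗ[k] m.Cotangent := m.toCotangent.restrictScalars k
  let d : m →ₗ[k] k := (TrivSqZeroExt.sndHom k k).comp
    (g.toLinearMap.comp ((m.restrictScalars k).subtype))
  -- On a product of two elements of the maximal ideal the ε-part vanishes by the Leibniz rule,
  -- because both have value `0` at `x`.
  have hd : LinearMap.ker q ≤ LinearMap.ker d := by
    rintro ⟨a, ha⟩ h
    have h1 : a ∈ m ^ 2 := (m.toCotangent_eq_zero ⟨a, ha⟩).1 h
    have h2 : (g a).snd = 0 := by
      rw [pow_two] at h1
      refine Submodule.mul_induction_on h1 (fun b hb c hc => ?_) fun b c hb hc => ?_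
      · rw [map_mul, TrivSqZeroExt.snd_mul, hg, hg, eval_eq_zero_of_mem x hb,
          eval_eq_zero_of_mem x hc]
        simp
      · rw [map_add, TrivSqZeroExt.snd_add, hb, hc, add_zero]
    exact h2
  have hq : LinearMap.range q = ⊤ := LinearMap.range_eq_top.2 m.toCotangent_surjective
  let v : TangentSpace x := ((LinearMap.ker q).liftQ d hd).comp
    (q.quotKerEquivOfSurjective (LinearMap.range_eq_top.1 hq)).symm.toLinearMap
  have hv : ∀ a : m, v (m.toCotangent a) = (g a).snd := by
    intro a
    have h1 : (q.quotKerEquivOfSurjective (LinearMap.range_eq_top.1 hq)).symm (q a) =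
      (LinearMap.ker q).mkQ a := by
      rw [LinearEquiv.symm_apply_eq]
      rfl
    change (LinearMap.ker q).liftQ d hd ((q.quotKerEquivOfSurjective _).symm (q a)) = _
    rw [h1]
    rfl
  refine ⟨v, AlgHom.ext fun a => ?_⟩
  rw [tangentHom_apply]
  ext
  · simp [hg]
  · have h1 := hv ⟨_, sub_eval_mem x a⟩
    have h2 : v (differential x a) = (g (a - algebraMap k (Stalk x) (eval x a))).snd := h1
    rw [map_sub, AlgHom.commutes] at h2
    simp [h2, TrivSqZeroExt.algebraMap_eq_inl]

/-- The point `y` is kept as a variable so that the equation can be substituted and no transport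
between stalks is needed. -/
lemma exists_specMap_fromSpecStalk {B : CommRingCat.{u}} [IsLocalRing B] (p : Spec B ⟶ X) (y : X)
    (h : p (IsLocalRing.closedPoint B) = y) :
    ∃ g : X.presheaf.stalk y ⟶ B, Spec.map g ≫ X.fromSpecStalk y = p := by
  subst h
  exact ⟨Scheme.stalkClosedPointTo p, Scheme.Spec_stalkClosedPointTo_fromSpecStalk p⟩

/-- The reduction `k[ε] → k` is local, so `p` sends the closed point to the point of `x` and factors
through the local ring there; the resulting homomorphism lifts evaluation at `x`. -/
lemma exists_tangentPoint_eq (p : Points s (DualNumber k))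
    (hp : p.map (TrivSqZeroExt.fstHom k k k) = x) : ∃ v, tangentPoint x v = p := by
  have hp' : Spec.map (CommRingCat.ofHom (TrivSqZeroExt.fstHom k k k).toRingHom) ≫ p.hom =
    x.hom := congrArg Points.hom hp
  have hpt : p.hom (IsLocalRing.closedPoint (CommRingCat.of (DualNumber k))) = x.point := by
    have hloc : IsLocalHom (TrivSqZeroExt.fstHom k k k).toRingHom :=
      ⟨fun a ha => TrivSqZeroExt.isUnit_iff_isUnit_fst.2 ha⟩
    have h0 : Spec.map (CommRingCat.ofHom (TrivSqZeroExt.fstHom k k k).toRingHom)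
        (IsLocalRing.closedPoint (CommRingCat.of k)) =
          IsLocalRing.closedPoint (CommRingCat.of (DualNumber k)) :=
      IsLocalRing.comap_closedPoint (TrivSqZeroExt.fstHom k k k).toRingHom
    have h1 : x.point = (Spec.map (CommRingCat.ofHom (TrivSqZeroExt.fstHom k k k).toRingHom) ≫
        p.hom) (IsLocalRing.closedPoint (CommRingCat.of k)) := by
      rw [hp']
      rfl
    exact (h1.trans ((Scheme.Hom.comp_apply _ _ _).trans (congrArg p.hom h0))).symm
  obtain ⟨g, hg⟩ := exists_specMap_fromSpecStalk p.hom x.point hpt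
  have h1 : structureHom x ≫ g = CommRingCat.ofHom (algebraMap k (DualNumber k)) := by
    apply Spec.map_injective
    rw [Spec.map_comp, ← fromSpecStalk_structure, reassoc_of% hg, p.hom_comp]
  have h2 : g ≫ CommRingCat.ofHom (TrivSqZeroExt.fstHom k k k).toRingHom = evalHom x := by
    apply Spec.map_injective
    rw [← cancel_mono (X.fromSpecStalk x.point), Spec.map_comp, Category.assoc, hg,
      evalHom_fromSpecStalk, hp']
  let g' : Stalk x →ₐ[k] DualNumber k :=
    { g.hom with commutes' := fun a => congrArg (fun f => f.hom a) h1 }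
  obtain ⟨v, hv⟩ := exists_tangentHom_eq x g' fun a => congrArg (fun f => f.hom a) h2
  refine ⟨v, ?_⟩
  ext1
  have h3 : tangentStalkHom x v = g :=
    CommRingCat.hom_ext (RingHom.ext fun a => congrArg (fun f => f a) hv)
  change Spec.map (tangentStalkHom x v) ≫ _ = _
  rw [h3, hg]

/-- The algebra homomorphism to `k[ε₁, ε₂] / (ε₁, ε₂)²` given by two tangent vectors. -/
def tangentPairHom (v w : TangentSpace x) : Stalk x →ₐ[k] TrivSqZeroExt k (k × k) :=
  AlgHom.ofLinearMap
    ((TrivSqZeroExt.inlAlgHom k k (k × k)).toLinearMap.comp (eval x).toLinearMap +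
      (TrivSqZeroExt.inrHom k (k × k)).comp ((v.prod w).comp (differential x)))
    (by
      ext <;> simp [differential_one])
    (by
      intro a b
      ext
      · simp
      · simp [differential_mul, mul_comm]
      · simp [differential_mul, mul_comm])

/-- `tangentPairHom` as a morphism in the category of commutative rings. -/
def tangentPairStalkHom (v w : TangentSpace x) :
    X.presheaf.stalk x.point ⟶ CommRingCat.of (TrivSqZeroExt k (k × k)) :=
  CommRingCat.ofHom (R := Stalk x) (tangentPairHom x v w).toRingHom

/-- The point with values in `k[ε₁, ε₂] / (ε₁, ε₂)²` given by two tangent vectors. -/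
def tangentPairPoint (v w : TangentSpace x) : Points s (TrivSqZeroExt k (k × k)) where
  hom := Spec.map (tangentPairStalkHom x v w) ≫ X.fromSpecStalk x.point
  hom_comp := by
    have h : structureHom x ≫ tangentPairStalkHom x v w =
        CommRingCat.ofHom (algebraMap k (TrivSqZeroExt k (k × k))) :=
      CommRingCat.hom_ext (RingHom.ext fun a => (tangentPairHom x v w).commutes a)
    rw [Category.assoc, fromSpecStalk_structure, ← Spec.map_comp, h]

/-- The homomorphism `ε₁ ↦ c ε`, `ε₂ ↦ d ε`. -/
abbrev pairHom (c d : k) : TrivSqZeroExt k (k × k) →ₐ[k] DualNumber k :=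
  TrivSqZeroExt.map (c • LinearMap.fst k k k + d • LinearMap.snd k k k)

lemma pairHom_tangentPairHom (v w : TangentSpace x) (c d : k) (a : Stalk x) :
    pairHom c d (tangentPairHom x v w a) = tangentHom x (c • v + d • w) a := by
  rw [tangentHom_apply]
  change pairHom c d (TrivSqZeroExt.inl (eval x a) +
    TrivSqZeroExt.inr (v (differential x a), w (differential x a))) = _
  ext <;> simp

/-- One point carries the whole plane of combinations of `v` and `w`, which turns naturality of the
representing bijection into linearity. -/
lemma tangentPairPoint_map (v w : TangentSpace x) (c d : k) :
    (tangentPairPoint x v w).map (pairHom c d) = tangentPoint x (c • v + d • w) := by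
  ext1
  have h : tangentPairStalkHom x v w ≫ CommRingCat.ofHom (pairHom c d).toRingHom =
      tangentStalkHom x (c • v + d • w) :=
    CommRingCat.hom_ext (RingHom.ext fun a =>
      pairHom_tangentPairHom x v w c d a)
  change Spec.map _ ≫ Spec.map _ ≫ X.fromSpecStalk x.point = Spec.map _ ≫ _
  rw [← Spec.map_comp_assoc, h]

instance : IsNoetherianRing (TrivSqZeroExt k (k × k)) :=
  have : Module.Finite k (TrivSqZeroExt k (k × k)) :=
    inferInstanceAs (Module.Finite k (k × (k × k)))
  IsNoetherianRing.of_finite k _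

end Points

/-! ### Linearity of the correspondence between tangent vectors and maps. -/

section Pair

variable {r : ℕ} {k : Type u} [Field k]

/-- The polynomials `f`, `g`, `h` are the coefficients of `1`, `ε₁`, `ε₂`; what matters is that they
do not depend on `c` and `d`. -/
lemma exists_map_pairHom_eq (F : PolyRing r (TrivSqZeroExt k (k × k))) :
    ∃ f g h : PolyRing r k, ∀ c d : k,
      MvPolynomial.map (pairHom c d).toRingHom F = addEps f (c • g + d • h) := by
  induction F using MvPolynomial.induction_on with
  | C a =>
    refine ⟨MvPolynomial.C a.fst, MvPolynomial.C a.snd.1, MvPolynomial.C a.snd.2, fun c d => ?_⟩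
    ext m : 1
    rw [MvPolynomial.map_C, coeff_addEps]
    simp only [MvPolynomial.coeff_add, MvPolynomial.coeff_smul, MvPolynomial.coeff_C]
    split_ifs
    · ext <;> simp
    · simp
  | add p q hp hq =>
    obtain ⟨f, g, h, H⟩ := hp
    obtain ⟨f', g', h', H'⟩ := hq
    refine ⟨f + f', g + g', h + h', fun c d => ?_⟩
    rw [map_add, H, H', addEps_add]
    congr 1
    rw [smul_add, smul_add]
    abel
  | mul_X p n hp =>
    obtain ⟨f, g, h, H⟩ := hp
    refine ⟨f * MvPolynomial.X n, g * MvPolynomial.X n, h * MvPolynomial.X n, fun c d => ?_⟩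
    rw [map_mul, H, MvPolynomial.map_X]
    have hX : (MvPolynomial.X n : PolyRing r (DualNumber k)) = addEps (MvPolynomial.X n) 0 := by
      simp [addEps]
    rw [hX, addEps_mul, mul_zero, zero_add, add_mul, smul_mul_assoc, smul_mul_assoc]

/-- One element of `I` lifting `f` specializes into all three ideals, so the values of `φ`, `ψ` and
`θ` at `f` are represented by `g`, `h` and `cg + dh`. -/
lemma deformationIdeal_linear {I₀ : Ideal (PolyRing r k)}
    {I : Ideal (PolyRing r (TrivSqZeroExt k (k × k)))}
    {φ ψ θ : I₀ →ₗ[PolyRing r k] (PolyRing r k ⧸ I₀)} {c d : k}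
    (hφ : baseChange (pairHom 1 0).toRingHom I = deformationIdeal φ)
    (hψ : baseChange (pairHom 0 1).toRingHom I = deformationIdeal ψ)
    (hθ : baseChange (pairHom c d).toRingHom I = deformationIdeal θ) :
    θ = c • φ + d • ψ := by
  ext f
  obtain ⟨g₀, hg₀⟩ := Ideal.Quotient.mk_surjective (φ f)
  have h1 : addEps f.1 g₀ ∈ baseChange (pairHom (1 : k) 0).toRingHom I := by
    rw [hφ]
    exact addEps_mem_deformationIdeal.2 ⟨f.2, hg₀.symm⟩
  -- Along a surjection the extended ideal is just the image of `I`, so elements of it lift to `I`.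
  have hsurj : Function.Surjective (pairHom (1 : k) 0).toRingHom := fun a =>
    ⟨TrivSqZeroExt.inl a.fst + TrivSqZeroExt.inr (a.snd, 0), by
      change pairHom (1 : k) 0 _ = _
      ext <;> simp⟩
  obtain ⟨F, hF, hF'⟩ := (Ideal.mem_map_iff_of_surjective _
    (MvPolynomial.map_surjective _ hsurj)).1 h1
  obtain ⟨f', g, h, H⟩ := exists_map_pairHom_eq F
  obtain ⟨rfl, -⟩ := addEps_injective ((H 1 0).symm.trans hF')
  have hmem : ∀ (a b : k) (χ : I₀ →ₗ[PolyRing r k] (PolyRing r k ⧸ I₀)),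
      baseChange (pairHom a b).toRingHom I = deformationIdeal χ →
        χ f = Ideal.Quotient.mk I₀ (a • g + b • h) := by
    intro a b χ hχ
    have h2 : addEps f.1 (a • g + b • h) ∈ deformationIdeal χ := by
      rw [← hχ, ← H]
      exact Ideal.mem_map_of_mem _ hF
    obtain ⟨_, h3⟩ := addEps_mem_deformationIdeal.1 h2
    exact h3
  rw [hmem c d θ hθ, LinearMap.add_apply, LinearMap.smul_apply, LinearMap.smul_apply,
    hmem 1 0 φ hφ, hmem 0 1 ψ hψ, one_smul, one_smul, zero_smul, zero_smul, add_zero, zero_add]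
  rfl

end Pair

variable {r : ℕ} {k : Type u} [Field k] {I₀ : Ideal (PolyRing r k)}

/-- Injectivity and surjectivity come from representability: an ideal `I_φ` with `φ ∈ T` is the
ideal of some `k[ε]`-point, whose reduction has ideal `I₀` and is therefore `x`, so the point is
given by a tangent vector. -/
lemma exists_tangentSpace_equiv (hI₀ : IsHomogeneousIdeal I₀) (F : FiberFullScheme r k)
    (x : Points F.s k) (hx : F.ideal k x = I₀) :
    ∃ e : TangentSpace x ≃ₗ[k] locCohTangent I₀, ∀ v : TangentSpace x,
      F.ideal (DualNumber k) (tangentPoint x v) = deformationIdeal (e v).1.1 := by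
  have hbij := bijOn_deformationIdeal hI₀
  have hfib : ∀ v : TangentSpace x, F.ideal (DualNumber k) (tangentPoint x v) ∈
      localFib I₀ (TrivSqZeroExt.fstHom k k k).toRingHom := fun v =>
    ⟨F.range_ideal (DualNumber k) ▸ Set.mem_range_self _, by
      rw [← F.ideal_map, tangentPoint_map_fst, hx]⟩
  choose E hE hE' using fun v => hbij.surjOn (hfib v)
  have hlin : ∀ (c d : k) (v w : TangentSpace x), E (c • v + d • w) = c • E v + d • E w := by
    intro c d v w
    ext1
    have h : ∀ a b : k, baseChange (pairHom a b).toRingHom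
        (F.ideal _ (tangentPairPoint x v w)) = deformationIdeal (E (a • v + b • w)).1 :=
      fun a b => by
        rw [← F.ideal_map, tangentPairPoint_map]
        exact (hE' _).symm
    have h1 := h 1 0
    have h2 := h 0 1
    rw [one_smul, zero_smul, add_zero] at h1
    rw [one_smul, zero_smul, zero_add] at h2
    exact deformationIdeal_linear h1 h2 (h c d)
  let e : TangentSpace x →ₗ[k] locCohTangent I₀ :=
    { toFun := fun v => ⟨E v, hE v⟩
      map_add' := fun v w => Subtype.ext (by simpa using hlin 1 1 v w)
      map_smul' := fun c v => Subtype.ext (by simpa using hlin c 0 v v) }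
  refine ⟨LinearEquiv.ofBijective e ⟨fun v w h => ?_, fun φ => ?_⟩, fun v => (hE' v).symm⟩
  · have h1 : E v = E w := congrArg Subtype.val h
    refine tangentPoint_injective x (F.ideal_injective (DualNumber k) ?_)
    rw [← hE', ← hE', h1]
  · obtain ⟨h1, h2⟩ := hbij.mapsTo φ.2
    rw [← F.range_ideal] at h1
    obtain ⟨p, hp⟩ := h1
    obtain ⟨v, rfl⟩ := exists_tangentPoint_eq x p (F.ideal_injective k (by
      rw [F.ideal_map, hp, hx]
      exact h2))
    refine ⟨v, Subtype.ext (hbij.injOn (hE v) φ.2 ?_)⟩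
    exact (hE' v).trans hp

end FiberFull

end

theorem theorem4p6 {k : Type u} [Field k] (r : ℕ) (I₀ : Ideal (FiberFull.PolyRing r k))
    (hI₀ : FiberFull.IsHomogeneousIdeal I₀) :
    ∃ T : Submodule k (FiberFull.homDegreeZero I₀),
      (∀ φ : FiberFull.homDegreeZero I₀, φ ∈ T ↔ ∀ i : ℕ, FiberFull.localCohMap i φ.1 = 0) ∧
      Set.BijOn (fun φ : FiberFull.homDegreeZero I₀ => FiberFull.deformationIdeal φ.1) T
        (FiberFull.localFib I₀ (TrivSqZeroExt.fstHom k k k).toRingHom) ∧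
      ∀ F : FiberFull.FiberFullScheme r k,
        ∃ x : FiberFull.Points F.s k, F.ideal k x = I₀ ∧
          ∃ e : FiberFull.TangentSpace x ≃ₗ[k] T, ∀ v : FiberFull.TangentSpace x,
            F.ideal (DualNumber k) (FiberFull.tangentPoint x v) =
              FiberFull.deformationIdeal (e v).1.1 := by
  refine ⟨FiberFull.locCohTangent I₀, fun φ => Iff.rfl, FiberFull.bijOn_deformationIdeal hI₀,
    fun F => ?_⟩
  obtain ⟨x, hx⟩ : I₀ ∈ Set.range (F.ideal k) :=
    (F.range_ideal k).symm ▸ FiberFull.mem_fib hI₀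
  exact ⟨x, hx, FiberFull.exists_tangentSpace_equiv hI₀ F x hx⟩
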